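/- For a positive integer $k\ge 3$ let $C_k$ be the cycle on $k$ vertices, and let $ex_{\mathcal P}(n,C_k)$ denote the maximum number of edges of a (finite, simple) planar graph on $n$ vertices that does not contain $C_k$ as a (not necessarily induced) subgraph. Let $n$ and $k$ be integers with $n\ge k\ge 11$, and let $r$ be the remainder of $n-4$ when divided by $k-6+\left\lfloor\frac{k-1}{2}\right\rfloor$. Then: (i) if $n\le k-5+\left\lfloor\frac{k-1}{2}\right\rfloor$, then $ex_{\mathcal P}(n,C_k)=3n-6$; (ii) if $n\ge k-4+\left\lfloor\frac{k-1}{2}\right\rfloor$, then $$ex_{\mathcal P}(n,C_k)\ \ge\ \left(3-\frac{3-\frac{2}{k-1}}{k-6+\left\lfloor\frac{k-1}{2}\right\rfloor}\right)n+\frac{12+3r-\frac{8+2r}{k-1}}{k-6+\left\lfloor\frac{k-1}{2}\right\rfloor}+\frac{4}{k-1}-\min\{r+10,\,11\}.$$ Moreover, if $k\ge 13$ and $n\ge \frac52\left(k-6+\left\lfloor\frac{k-1}{2}\right\rfloor\right)(k-1)$, then $$ex_{\mathcal P}(n,C_k)\ >\ \left(3-\frac3k\right)n-6-\frac6k ,$$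 so that the conjecture of Ghosh, Győri, Martin, Paulos and Xiao, that $ex_{\mathcal P}(n,C_k)\le\left(3-\frac3k\right)n-6-\frac6k$ for all $k\ge7$ and all sufficiently large $n$, fails for every $k\ge13$. -/

import Mathlib

namespace SimpleGraph

/-- A finite simple graph is planar if it can be drawn in the plane without crossings: there are
pairwise distinct points `p v` for the vertices such that, when every edge `uv` is drawn as the
closed segment from `p u` to `p v`,
* no edge passes through a vertex other than its two ends, and
* two distinct edges meet only in (the image of) a common end.

Drawing the edges as straight segments is no restriction: a finite simple graph that can be drawn
in the plane without crossings using arbitrary simple arcs also has such a straight-line drawing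
(Fáry, Wagner). -/
def IsPlanar {V : Type*} (G : SimpleGraph V) : Prop :=
  ∃ p : V → ℝ × ℝ,
    Function.Injective p ∧
    (∀ u v w : V, G.Adj u v → p w ∈ segment ℝ (p u) (p v) → w = u ∨ w = v) ∧
    (∀ u v x y : V, G.Adj u v → G.Adj x y → s(u, v) ≠ s(x, y) →
      segment ℝ (p u) (p v) ∩ segment ℝ (p x) (p y) ⊆ p '' (({u, v} : Set V) ∩ {x, y}))

open scoped Classical in
/-- The planar Turán number of `H`: the maximum number of edges of a planar graph on `n` vertices
that does not contain `H` as a (not necessarily induced) subgraph. -/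
noncomputable def planarTuranNumber (n : ℕ) {W : Type*} (H : SimpleGraph W) : ℕ :=
  Finset.sup {G : SimpleGraph (Fin n) | G.IsPlanar ∧ H.Free G} (fun G => G.edgeFinset.card)

end SimpleGraph

/-! The upper bound is the classical `3 n - 6`, obtained from a straight-line drawing without
Euler's formula. Direct every edge from left to right. The lowest edges leaving the vertices number
at most `n - 1`. Any other edge `u v'` has a next lower edge `u v`, and is charged to the leftmost
vertex `w` of the wedge between them, together with the information whether `w = v'`. Such a charge
determines the edge, the leftmost and rightmost vertices receive none, and some third vertex misses
one of its two charges: `(n - 1) + 2 (n - 2) - 1 = 3 n - 6` (`Segments.card_add_six_le`).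

For the lower bounds put `t = ⌊(k - 1) / 2⌋` and `m = k - 6 + t`. A block is a stacked triangulation
on `m + 1` vertices: the path `2, …, t + 1` is joined to both ends of the edge `0 1`, and further
vertices are put into the triangles `{σ, s, s + 1}`, `σ < 2`. The `t` core vertices `0, 1, 3, …, t`
cover all its edges if `k` is odd and all but one if `k` is even, so a cycle inside a block has
length at most `2 t` or `2 t + 1`, which is less than `k` in each case. This gives (i), as a block
or an initial part of it has `3 n - 6` edges.

For larger `n`, blocks are glued at single vertices into rings of `k + 1` blocks that all pass
through one hub. A cycle going around a ring has more than `k` vertices and the hub separates the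
rings, so every `k`-cycle lies in one block (`exists_block_of_cycle`). Each new block costs 3 edges
compared with `3 n`, and closing a ring saves one vertex and thus wins 3 back; this is counted
exactly in `code_succ`. The whole graph is part of one large stacked triangulation fanned around the
hub, which can be drawn by repeatedly placing a vertex at the barycenter of an empty triangle
(`exists_stackDrawing`).

The conjecture fails from `k = 13` on because then `k ≤ m`: the blocks cost at most `3 n / k`, and
the rings win back an amount growing with `n`. -/

namespace PlanarTuran

/-! ### The upper bound `3 n - 6` by charging edges to wedges -/

/-- A straight-line drawing of non-crossing segments over vertices with pairwise distinct
abscissae `X`; `E u v` says that there is a segment from `u` to the right to `v`. -/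
structure Segments (V : Type*) where
  X : V → ℝ
  Y : V → ℝ
  E : V → V → Prop
  inj : Function.Injective X
  lt : ∀ {u v}, E u v → X u < X v
  vertex : ∀ {u v w}, E u v → X u ≤ X w → X w ≤ X v →
    Y w = Y u + (X w - X u) * ((Y v - Y u) / (X v - X u)) → w = u ∨ w = v
  cross : ∀ {u v u' v' x}, E u v → E u' v' → (u, v) ≠ (u', v') → X u ≤ x → x ≤ X v →
    X u' ≤ x → x ≤ X v' →
    Y u + (x - X u) * ((Y v - Y u) / (X v - X u))
      = Y u' + (x - X u') * ((Y v' - Y u') / (X v' - X u')) →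
    ∃ z, (z = u ∨ z = v) ∧ (z = u' ∨ z = v') ∧ X z = x

namespace Segments

variable {V : Type*} (S : Segments V)

/-- The slope of the segment from `u` to `v`. -/
noncomputable def slope (u v : V) : ℝ := (S.Y v - S.Y u) / (S.X v - S.X u)

/-- The height over `x` of the line through `u` and `v`. -/
noncomputable def line (u v : V) (x : ℝ) : ℝ := S.Y u + (x - S.X u) * S.slope u v

@[simp] lemma line_left (u v : V) : S.line u v (S.X u) = S.Y u := by simp [line]

lemma line_right {u v : V} (h : S.E u v) : S.line u v (S.X v) = S.Y v := by
  have := S.lt h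
  have h' : S.X v - S.X u ≠ 0 := by linarith
  simp only [line, slope]
  field_simp
  ring

/-- If the order were reversed at `a`, the segments would meet strictly between `a` and `b` by the
intermediate value theorem, but neither end of the first segment lies over that open interval. -/
lemma line_le_line {u v : V} (h : S.E u v) {u' v' : V} (h' : S.E u' v')
    (hne : (u, v) ≠ (u', v')) {a b : ℝ} (hab : a < b) (hua : S.X u ≤ a) (hua' : S.X u' ≤ a)
    (hbv : b ≤ S.X v) (hbv' : b ≤ S.X v') (hb : S.line u v b < S.line u' v' b) :
    S.line u v a ≤ S.line u' v' a := by
  by_contra! hlt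
  have hc : ContinuousOn (fun x => S.line u v x - S.line u' v' x) (Set.Icc a b) := by
    unfold line; fun_prop
  obtain ⟨x, hx, hx0⟩ := intermediate_value_Ioo' hab.le hc
    (show (0 : ℝ) ∈ Set.Ioo _ _ from ⟨by simpa using hb, by simpa using hlt⟩)
  obtain ⟨z, h1, -, h3⟩ := S.cross h h' hne (hua.trans hx.1.le) (hx.2.le.trans hbv)
    (hua'.trans hx.1.le) (hx.2.le.trans hbv') (by simpa [line, slope] using sub_eq_zero.1 hx0)
  have := hx.1
  have := hx.2
  rcases h1 with rfl | rfl <;> linarith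

lemma slope_inj {u v v' : V} (h : S.E u v) (h' : S.E u v') (hs : S.slope u v = S.slope u v') :
    v = v' := by
  wlog hle : S.X v ≤ S.X v' generalizing v v'
  · exact (this h' h hs.symm (le_of_not_ge hle)).symm
  have h1 : S.Y v = S.line u v (S.X v) := (S.line_right h).symm
  rw [line, hs] at h1
  rcases S.vertex h' (S.lt h).le hle h1 with h2 | h2
  · have := S.lt h
    rw [h2] at this
    exact absurd this (lt_irrefl _)
  · exact h2

/-- The segments from `u` to `v` and to `v'` are consecutive among those going right from `u`,
the latter being the upper one, and `w` is the leftmost vertex other than `u` in the closed wedge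
between them. -/
structure Wedge (u v v' w : V) : Prop where
  lower : S.E u v
  upper : S.E u v'
  slope_lt : S.slope u v < S.slope u v'
  consecutive : ∀ z, S.E u z → S.slope u z < S.slope u v' → S.slope u z ≤ S.slope u v
  right : S.X u < S.X w
  le : S.line u v (S.X w) ≤ S.Y w
  ge : S.Y w ≤ S.line u v' (S.X w)
  leftmost : ∀ z, S.X u < S.X z → S.line u v (S.X z) ≤ S.Y z → S.Y z ≤ S.line u v' (S.X z) →
    S.X w ≤ S.X z

lemma exists_wedge [Finite V] {u v v' : V} (h : S.E u v) (h' : S.E u v')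
    (hlt : S.slope u v < S.slope u v') : ∃ v w, S.Wedge u v v' w := by
  obtain ⟨a, ⟨ha1, ha2⟩, ha3⟩ :=
    (Set.toFinite {z | S.E u z ∧ S.slope u z < S.slope u v'}).exists_maximalFor
      (S.slope u) _ ⟨v, h, hlt⟩
  have hv' : v' ∈ {z | S.X u < S.X z ∧ S.line u a (S.X z) ≤ S.Y z ∧
      S.Y z ≤ S.line u v' (S.X z)} := by
    refine ⟨S.lt h', ?_, (S.line_right h').ge⟩
    rw [← S.line_right h']
    have := S.lt h'
    unfold line
    gcongr
  obtain ⟨w, ⟨hw1, hw2, hw3⟩, hw4⟩ := (Set.toFinite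
    {z | S.X u < S.X z ∧ S.line u a (S.X z) ≤ S.Y z ∧
      S.Y z ≤ S.line u v' (S.X z)}).exists_minimalFor S.X _ ⟨v', hv'⟩
  refine ⟨a, w, ha1, h', ha2, fun z hz hz' => ?_, hw1, hw2, hw3, fun z h1 h2 h3 => ?_⟩
  · rcases le_total (S.slope u z) (S.slope u a) with h | h
    · exact h
    · exact ha3 ⟨hz, hz'⟩ h
  · rcases le_total (S.X w) (S.X z) with h | h
    · exact h
    · exact hw4 ⟨h1, h2, h3⟩ h

namespace Wedge

variable {S} {u v v' w : V}

lemma le_lower (W : S.Wedge u v v' w) : S.X w ≤ S.X v := by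
  have := S.lt W.lower
  have := W.slope_lt
  refine W.leftmost _ (S.lt W.lower) (S.line_right W.lower).le ?_
  rw [← S.line_right W.lower]
  unfold line
  gcongr

lemma le_upper (W : S.Wedge u v v' w) : S.X w ≤ S.X v' := by
  have := S.lt W.upper
  have := W.slope_lt
  refine W.leftmost _ (S.lt W.upper) ?_ (S.line_right W.upper).ge
  rw [← S.line_right W.upper]
  unfold line
  gcongr

lemma lt_line (W : S.Wedge u v v' w) (h : w ≠ v') : S.Y w < S.line u v' (S.X w) := by
  refine lt_of_le_of_ne W.ge fun he => ?_
  rcases S.vertex W.upper W.right.le W.le_upper he with h1 | h1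
  · exact W.right.ne (by rw [h1])
  · exact h h1

lemma line_lt (W : S.Wedge u v v' w) (h : w = v') : S.line u v (S.X w) < S.Y w := by
  refine lt_of_le_of_ne W.le fun he => ?_
  rcases S.vertex W.lower W.right.le W.le_lower he.symm with h1 | h1
  · exact W.right.ne (by rw [h1])
  · exact W.slope_lt.ne (by rw [← h1, h])

/-- An edge from `a` that stays in the wedge to the left of its vertex `w` starts at `u`. -/
lemma source_eq (W : S.Wedge u v v' w) {a b : V} (h : S.E a b) (ha : S.X a < S.X w)
    (h1 : ∀ x, S.X a ≤ x → S.X u ≤ x → x < S.X w → S.line u v x ≤ S.line a b x)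
    (h2 : ∀ x, S.X a ≤ x → S.X u ≤ x → x < S.X w → S.line a b x ≤ S.line u v' x)
    (hb : S.X w ≤ S.X b) : a = u := by
  rcases lt_trichotomy (S.X a) (S.X u) with h3 | h3 | h3
  · have e1 := h1 _ h3.le le_rfl W.right
    have e2 := h2 _ h3.le le_rfl W.right
    rw [line_left] at e1 e2
    rcases S.vertex h h3.le (W.right.le.trans hb) (le_antisymm e1 e2) with h4 | h4
    · exact h4.symm
    · rw [← h4] at hb
      exact absurd W.right (not_lt.2 hb)
  · exact S.inj h3
  · have e1 := h1 _ le_rfl h3.le ha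
    have e2 := h2 _ le_rfl h3.le ha
    rw [line_left] at e1 e2
    exact absurd ha (not_lt.2 (W.leftmost a h3 e1 e2))

/-- The edge charged is the one directly above `w`. If one of two upper edges ran lower over `w`, it
would be squeezed into the wedge of the other, hence start at the same vertex and lie strictly
between two consecutive edges. -/
lemma eq_of_ne_upper (W : S.Wedge u v v' w) {u₂ v₂ v₂' : V} (W₂ : S.Wedge u₂ v₂ v₂' w)
    (h : w ≠ v') (h₂ : w ≠ v₂') : (u, v') = (u₂, v₂') := by
  wlog hle : S.line u v' (S.X w) ≤ S.line u₂ v₂' (S.X w) generalizing u v v' u₂ v₂ v₂'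
  · exact (this W₂ W h₂ h (le_of_not_ge hle)).symm
  by_contra hne
  have hlt := lt_of_le_of_ne hle fun he => by
    obtain ⟨z, h1, -, h3⟩ := S.cross W.upper W₂.upper hne W.right.le W.le_upper W₂.right.le
      W₂.le_upper he
    rcases h1 with rfl | rfl
    · exact W.right.ne h3
    · exact h (S.inj h3.symm)
  have hw := W.lt_line h
  have hlt' : S.line u₂ v₂ (S.X w) < S.line u v' (S.X w) := W₂.le.trans_lt hw
  have hne' : (u₂, v₂) ≠ (u, v') := by
    rintro he
    rw [Prod.mk.injEq] at he
    rw [he.1, he.2] at hlt'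
    exact lt_irrefl _ hlt'
  have hu : u = u₂ := W₂.source_eq W.upper W.right
    (fun x hx hx' hxw => S.line_le_line W₂.lower W.upper hne' hxw hx' hx W₂.le_lower W.le_upper hlt')
    (fun x hx hx' hxw => S.line_le_line W.upper W₂.upper hne hxw hx hx' W.le_upper W₂.le_upper hlt)
    W.le_upper
  subst hu
  have hr : 0 < S.X w - S.X u := by linarith [W.right]
  have s1 : S.slope u v' < S.slope u v₂' := by
    simp only [line] at hlt
    nlinarith
  have s2 : S.slope u v₂ < S.slope u v' := by
    simp only [line] at hlt'
    nlinarith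
  exact absurd (W₂.consecutive _ W.upper s1) (not_le.2 s2)

/-- Both upper edges end in `w`. The lower one, `a w`, stays below `c w` and cannot cross `c d`,
which passes below `w`; so it is squeezed into the second wedge and `source_eq` applies. -/
lemma source_eq_of_line_lt {a b c d : V} (W : S.Wedge a b w w) (W₂ : S.Wedge c d w w)
    (hl : S.line a w (max (S.X a) (S.X c)) < S.line c w (max (S.X a) (S.X c))) : a = c := by
  have e2 : S.line a w (S.X w) = S.Y w := S.line_right W.upper
  have e4 : S.line c w (S.X w) = S.Y w := S.line_right W₂.upper
  have hlt : max (S.X a) (S.X c) < S.X w := max_lt W.right W₂.right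
  have hcd : S.line c d (S.X w) < S.line a w (S.X w) := by
    rw [e2]; exact W₂.line_lt rfl
  have hne' : (c, d) ≠ (a, w) := by
    rintro he
    rw [Prod.mk.injEq] at he
    rw [he.1, he.2] at hcd
    exact lt_irrefl _ hcd
  refine W₂.source_eq W.upper W.right (fun x hx hx' hxw => S.line_le_line W₂.lower W.upper hne'
    hxw hx' hx W₂.le_lower le_rfl hcd) (fun x hx hx' hxw => ?_) le_rfl
  simp only [line] at e2 e4 hl ⊢
  have h5 : 0 < (S.X w - max (S.X a) (S.X c)) * (S.slope a w - S.slope c w) := by nlinarith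
  have h6 : 0 < S.slope a w - S.slope c w := by
    by_contra! h7
    nlinarith
  nlinarith

lemma eq_of_eq_upper (W : S.Wedge u v v' w) {u₂ v₂ v₂' : V} (W₂ : S.Wedge u₂ v₂ v₂' w)
    (h : w = v') (h₂ : w = v₂') : (u, v') = (u₂, v₂') := by
  subst h
  subst h₂
  by_contra hne
  have huu : u ≠ u₂ := fun h => hne (by rw [h])
  rcases lt_trichotomy (S.line u w (max (S.X u) (S.X u₂))) (S.line u₂ w (max (S.X u) (S.X u₂)))
    with h | h | h
  · exact huu (W.source_eq_of_line_lt W₂ h)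
  · have hlt : max (S.X u) (S.X u₂) < S.X w := max_lt W.right W₂.right
    obtain ⟨z, h1, h2, h3⟩ := S.cross W.upper W₂.upper hne (le_max_left _ _) hlt.le
      (le_max_right _ _) hlt.le h
    rcases h1 with rfl | rfl
    · rcases h2 with h2 | h2
      · exact huu h2
      · exact W.right.ne (by rw [h2])
    · exact hlt.ne h3.symm
  · rw [max_comm] at h
    exact huu (W₂.source_eq_of_line_lt W h).symm

end Wedge

/-- The height of a vertex over the line through `a` and `b`. -/
noncomputable def height (a b z : V) : ℝ := S.Y z - S.line a b (S.X z)

/-- The height over a fixed line is affine along a segment, so its extremes are at the ends. -/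
lemma line_le_of_height_le (a b : V) {u v : V} (h : S.E u v) {x c : ℝ} (hu : S.X u ≤ x)
    (hv : x ≤ S.X v) (h1 : S.height a b u ≤ c) (h2 : S.height a b v ≤ c) :
    S.line u v x - S.line a b x ≤ c := by
  simp only [height, ← S.line_right h] at h1 h2
  simp only [line] at *
  rcases le_total (S.slope u v) (S.slope a b) with h3 | h3 <;> nlinarith

lemma le_line_of_le_height (a b : V) {u v : V} (h : S.E u v) {x c : ℝ} (hu : S.X u ≤ x)
    (hv : x ≤ S.X v) (h1 : c ≤ S.height a b u) (h2 : c ≤ S.height a b v) :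
    c ≤ S.line u v x - S.line a b x := by
  simp only [height, ← S.line_right h] at h1 h2
  simp only [line] at *
  rcases le_total (S.slope u v) (S.slope a b) with h3 | h3 <;> nlinarith

/-- A vertex on the boundary of the convex hull other than the leftmost and the rightmost one is
not the leftmost vertex of a wedge above it or not of a wedge below it. -/
lemma exists_boundary [Finite V] {a b c : V} (hca : c ≠ a) (hcb : c ≠ b)
    (hab : S.X a < S.X b) : ∃ z, z ≠ a ∧ z ≠ b ∧
      ((∀ u v v', S.Wedge u v v' z → z = v') ∨ ∀ u v v', S.Wedge u v v' z → z ≠ v') := by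
  have ha : S.height a b a = 0 := by simp [height]
  have hb : S.height a b b = 0 := by
    have : S.X b - S.X a ≠ 0 := by linarith
    simp only [height, line, slope]
    field_simp
    ring
  obtain ⟨z, ⟨hz1, hz2⟩, hz3⟩ :=
    (Set.toFinite {z | z ≠ a ∧ z ≠ b}).exists_maximalFor (S.height a b) _ ⟨c, hca, hcb⟩
  obtain ⟨y, ⟨hy1, hy2⟩, hy3⟩ :=
    (Set.toFinite {z | z ≠ a ∧ z ≠ b}).exists_minimalFor (S.height a b) _ ⟨c, hca, hcb⟩
  -- If the highest vertex other than `a`, `b` is on or above `a b`, no edge passes above it.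
  -- Otherwise all other vertices are below `a b`, and no edge passes below the lowest one.
  rcases le_or_gt 0 (S.height a b z) with h0 | h0
  · have hmax : ∀ x, S.height a b x ≤ S.height a b z := by
      intro x
      by_cases hxa : x = a
      · rw [hxa, ha]; exact h0
      by_cases hxb : x = b
      · rw [hxb, hb]; exact h0
      rcases le_total (S.height a b x) (S.height a b z) with h | h
      · exact h
      · exact hz3 ⟨hxa, hxb⟩ h
    refine ⟨z, hz1, hz2, Or.inl fun u v v' W => ?_⟩
    by_contra hne
    have h1 := W.lt_line hne
    have h2 := S.line_le_of_height_le a b W.upper W.right.le W.le_upper (hmax _) (hmax _)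
    simp only [height] at h2
    linarith
  · have hyz : S.height a b y ≤ S.height a b z := by
      rcases le_total (S.height a b y) (S.height a b z) with h | h
      · exact h
      · exact hy3 ⟨hz1, hz2⟩ h
    have hmin : ∀ x, S.height a b y ≤ S.height a b x := by
      intro x
      by_cases hxa : x = a
      · rw [hxa, ha]; linarith
      by_cases hxb : x = b
      · rw [hxb, hb]; linarith
      rcases le_total (S.height a b y) (S.height a b x) with h | h
      · exact h
      · exact hy3 ⟨hxa, hxb⟩ h
    refine ⟨y, hy1, hy2, Or.inr fun u v v' W he => ?_⟩
    have h1 := W.line_lt he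
    have h2 := S.le_line_of_le_height a b W.lower W.right.le W.le_lower (hmin _) (hmin _)
    simp only [height] at h2
    linarith

-- The edges split into the lowest ones at their left ends and those that are the upper side of a
-- wedge; the latter inject into pairs of a vertex and a Boolean.
open scoped Classical in
theorem card_add_six_le [Fintype V] (h3 : 3 ≤ Fintype.card V) :
    (Finset.univ.filter fun e : V × V => S.E e.1 e.2).card + 6 ≤ 3 * Fintype.card V := by
  have hne : Nonempty V := Fintype.card_pos_iff.1 (by omega)
  obtain ⟨a, -, ha⟩ := Finset.exists_min_image Finset.univ S.X Finset.univ_nonempty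
  obtain ⟨b, -, hb⟩ := Finset.exists_max_image Finset.univ S.X Finset.univ_nonempty
  simp only [Finset.mem_univ, true_implies] at ha hb
  have hab' : a ≠ b := by
    rintro rfl
    have : ∀ x, x = a := fun x => S.inj (le_antisymm (hb x) (ha x))
    have := Fintype.card_le_one_iff.2 fun x y => (this x).trans (this y).symm
    omega
  have hab : S.X a < S.X b := lt_of_le_of_ne (hb a) fun h => hab' (S.inj h)
  obtain ⟨c, hc⟩ : ∃ c, c ∉ ({a, b} : Finset V) := by
    by_contra! h
    have := Finset.card_le_card (fun x _ => h x : Finset.univ ⊆ ({a, b} : Finset V))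
    have := Finset.card_le_two (a := a) (b := b)
    rw [Finset.card_univ] at *
    omega
  simp only [Finset.mem_insert, Finset.mem_singleton, not_or] at hc
  obtain ⟨z, hza, hzb, hz⟩ := S.exists_boundary hc.1 hc.2 hab
  -- `β` is the kind of charge that the boundary vertex `z` never receives.
  obtain ⟨β, hβ⟩ : ∃ β : Bool, ∀ u v v', S.Wedge u v v' z → decide (z = v') ≠ β := by
    rcases hz with hz | hz
    · exact ⟨false, fun u v v' W => by simpa using hz u v v' W⟩
    · exact ⟨true, fun u v v' W => by simpa using hz u v v' W⟩
  set P : V × V → Prop := fun e => ∃ v, S.E e.1 v ∧ S.slope e.1 v < S.slope e.1 e.2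
  rw [← Finset.card_filter_add_card_filter_not (s := Finset.univ.filter fun e : V × V => S.E e.1 e.2)
    P]
  have h1 : ((Finset.univ.filter fun e : V × V => S.E e.1 e.2).filter fun e => ¬ P e).card
      ≤ (Finset.univ.erase b).card := by
    refine Finset.card_le_card_of_injOn Prod.fst ?_ ?_
    · rintro ⟨u, v⟩ he
      simp only [Finset.coe_filter, Finset.mem_filter, Finset.mem_univ, true_and,
        Set.mem_ofPred_eq] at he
      simp only [Finset.coe_erase, Finset.coe_univ, Set.mem_sdiff, Set.mem_univ, true_and,
        Set.mem_singleton_iff]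
      rintro rfl
      exact absurd (S.lt he.1) (not_lt.2 (hb v))
    · rintro ⟨u, v⟩ he ⟨u', v'⟩ he' (rfl : u = u')
      simp only [Finset.coe_filter, Finset.mem_filter, Finset.mem_univ, true_and,
        Set.mem_ofPred_eq, P, not_exists, not_and, not_lt] at he he'
      rw [S.slope_inj he.1 he'.1 (le_antisymm (he.2 _ he'.1) (he'.2 _ he.1))]
  -- The charge avoids `a`, which is left of no wedge vertex, and `b`, since both sides of a wedge
  -- reaching to `b` would end in `b`.
  have h2 : ((Finset.univ.filter fun e : V × V => S.E e.1 e.2).filter P).card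
      ≤ ((((Finset.univ.erase a).erase b) ×ˢ (Finset.univ : Finset Bool)).erase (z, β)).card := by
    have hw : ∀ e : V × V, ∃ w, S.E e.1 e.2 → P e → ∃ v, S.Wedge e.1 v e.2 w := by
      intro e
      by_cases h : S.E e.1 e.2 ∧ P e
      · obtain ⟨v, hv⟩ := h.2
        obtain ⟨v, w, W⟩ := S.exists_wedge hv.1 h.1 hv.2
        exact ⟨w, fun _ _ => ⟨v, W⟩⟩
      · exact ⟨a, fun h1 h2 => absurd ⟨h1, h2⟩ h⟩
    choose w hw using hw
    refine Finset.card_le_card_of_injOn (fun e => (w e, decide (w e = e.2))) ?_ ?_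
    · rintro e he
      simp only [Finset.coe_filter, Finset.mem_filter, Finset.mem_univ, true_and,
        Set.mem_ofPred_eq] at he
      obtain ⟨v, W⟩ := hw e he.1 he.2
      simp only [Finset.coe_erase, Finset.coe_product, Set.mem_sdiff, Set.mem_prod, Finset.coe_univ,
        Set.mem_univ, true_and, Set.mem_singleton_iff, and_true, Prod.mk.injEq, not_and]
      refine ⟨⟨fun h => ?_, fun h => ?_⟩, fun h => ?_⟩
      · have := W.right
        rw [h] at this
        exact absurd this (not_lt.2 (ha _))
      · have l1 := W.le_lower
        have l2 := W.le_upper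
        rw [h] at l1 l2
        have e1 : v = b := S.inj (le_antisymm (hb _) l1)
        have e2 : e.2 = b := S.inj (le_antisymm (hb _) l2)
        have := W.slope_lt
        rw [e1, e2] at this
        exact lt_irrefl _ this
      · rw [h] at W ⊢
        exact hβ _ _ _ W
    · rintro ⟨u, v'⟩ he ⟨u₂, v₂'⟩ he' heq
      simp only [Finset.coe_filter, Finset.mem_filter, Finset.mem_univ, true_and,
        Set.mem_ofPred_eq] at he he'
      obtain ⟨v, W⟩ := hw _ he.1 he.2
      obtain ⟨v₂, W₂⟩ := hw _ he'.1 he'.2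
      simp only [Prod.mk.injEq, decide_eq_decide] at heq
      rw [← heq.1] at W₂ heq
      by_cases h : w (u, v') = v'
      · exact W.eq_of_eq_upper W₂ h (heq.2.1 h)
      · exact W.eq_of_ne_upper W₂ h (fun h' => h (heq.2.2 h'))
  have h4 : (z, β) ∈ ((Finset.univ.erase a).erase b) ×ˢ (Finset.univ : Finset Bool) := by
    simp [hza, hzb]
  rw [Finset.card_erase_of_mem (Finset.mem_univ _), Finset.card_univ] at h1
  rw [Finset.card_erase_of_mem h4, Finset.card_product,
    Finset.card_erase_of_mem (by simpa using hab'.symm),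
    Finset.card_erase_of_mem (Finset.mem_univ _), Finset.card_univ, Finset.card_univ,
    Fintype.card_bool] at h2
  omega

end Segments

/-- The drawing of a planar graph, sheared so that no two vertices lie on a vertical line. -/
lemma exists_segments {V : Type*} [Finite V] {G : SimpleGraph V} (hG : G.IsPlanar) :
    ∃ S : Segments V, ∀ u v, S.E u v ↔ G.Adj u v ∧ S.X u < S.X v := by
  obtain ⟨p, hp, hv, he⟩ := hG
  -- All but finitely many shears `(x, y) ↦ (x + c y, y)` separate the abscissae of the vertices.
  obtain ⟨c, hc⟩ := (Set.finite_range fun e : V × V =>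
    -((p e.1).1 - (p e.2).1) / ((p e.1).2 - (p e.2).2)).exists_notMem
  have hinj : Function.Injective fun v => (p v).1 + c * (p v).2 := by
    intro u v huv
    simp only at huv
    by_contra hne
    by_cases h : (p u).2 = (p v).2
    · rw [h] at huv
      exact hne (hp (Prod.ext (by linarith) h))
    · refine hc ⟨(u, v), ?_⟩
      have : (p u).2 - (p v).2 ≠ 0 := sub_ne_zero.2 h
      simp only
      field_simp
      linarith
  -- The inverse shear takes points of the sheared segment back to the original one.
  have key : ∀ {u v : V} {x : ℝ}, (p u).1 + c * (p u).2 < (p v).1 + c * (p v).2 →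
      (p u).1 + c * (p u).2 ≤ x → x ≤ (p v).1 + c * (p v).2 → ∀ y, y = (p u).2 +
        (x - ((p u).1 + c * (p u).2)) * (((p v).2 - (p u).2) /
          ((p v).1 + c * (p v).2 - ((p u).1 + c * (p u).2))) →
      (x - c * y, y) ∈ segment ℝ (p u) (p v) := by
    intro u v x huv h1 h2 y hy
    have h0 : 0 < (p v).1 + c * (p v).2 - ((p u).1 + c * (p u).2) := by linarith
    refine ⟨1 - (x - ((p u).1 + c * (p u).2)) / ((p v).1 + c * (p v).2 - ((p u).1 + c * (p u).2)),
      (x - ((p u).1 + c * (p u).2)) / ((p v).1 + c * (p v).2 - ((p u).1 + c * (p u).2)),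
      ?_, div_nonneg (by linarith) h0.le, by ring, ?_⟩
    · rw [sub_nonneg, div_le_one h0]
      linarith
    · rw [hy]
      ext <;> simp only [Prod.fst_add, Prod.snd_add, Prod.smul_fst, Prod.smul_snd, smul_eq_mul] <;>
        field_simp <;> ring
  refine ⟨⟨fun v => (p v).1 + c * (p v).2, fun v => (p v).2,
    fun u v => G.Adj u v ∧ (p u).1 + c * (p u).2 < (p v).1 + c * (p v).2, hinj, fun h => h.2,
    fun {u v w} h h1 h2 h3 => hv u v w h.1 ?_, fun {u v u' v' x} h h' hne h1 h2 h1' h2' h3 => ?_⟩,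
    fun u v => Iff.rfl⟩
  · have := key h.2 h1 h2 _ h3
    simpa using this
  · have hne' : s(u, v) ≠ s(u', v') := by
      intro h4
      rcases Sym2.eq_iff.1 h4 with ⟨rfl, rfl⟩ | ⟨rfl, rfl⟩
      · exact hne rfl
      · exact lt_asymm h.2 h'.2
    obtain ⟨z, ⟨hz, hz'⟩, hzp⟩ := he u v u' v' h.1 h'.1 hne'
      ⟨key h.2 h1 h2 _ rfl, key h'.2 h1' h2' _ h3⟩
    refine ⟨z, hz, hz', ?_⟩
    rw [hzp]
    simp

/-- A planar graph on `n ≥ 3` vertices has at most `3 n - 6` edges. -/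
theorem IsPlanar.card_edgeFinset_add_six_le {V : Type*} [Fintype V] {G : SimpleGraph V}
    [Fintype G.edgeSet] (hG : G.IsPlanar) (h3 : 3 ≤ Fintype.card V) :
    G.edgeFinset.card + 6 ≤ 3 * Fintype.card V := by
  classical
  obtain ⟨S, hS⟩ := exists_segments hG
  refine le_trans (Nat.add_le_add_right ?_ 6) (S.card_add_six_le h3)
  refine le_trans (Finset.card_le_card ?_) (Finset.card_image_le (f := fun e : V × V => s(e.1, e.2)))
  intro e he
  induction e with | _ u v
  rw [SimpleGraph.mem_edgeFinset, SimpleGraph.mem_edgeSet] at he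
  simp only [Finset.mem_image, Finset.mem_filter, Finset.mem_univ, true_and, hS]
  rcases lt_or_gt_of_ne (fun h => he.ne (S.inj h)) with h | h
  · exact ⟨(u, v), ⟨he, h⟩, rfl⟩
  · exact ⟨(v, u), ⟨he.symm, h⟩, Sym2.eq_swap⟩

/-! ### Drawing stacked triangulations -/

section Stacking

variable {α : Type*}

/-- The points `p i` for `i ∈ X` are affinely independent. -/
def Indep (p : α → ℝ × ℝ) (X : Finset α) : Prop :=
  ∀ w : α → ℝ, ∑ i ∈ X, w i = 0 → ∑ i ∈ X, w i • p i = 0 → ∀ i ∈ X, w i = 0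

/-- The open simplex spanned by the points `p i` for `i ∈ X`. -/
def openSimplex (p : α → ℝ × ℝ) (X : Finset α) : Set (ℝ × ℝ) :=
  {q | ∃ w : α → ℝ, (∀ i ∈ X, 0 < w i) ∧ ∑ i ∈ X, w i = 1 ∧ ∑ i ∈ X, w i • p i = q}

lemma Indep.weights_eq {p : α → ℝ × ℝ} {X : Finset α} (h : Indep p X) {w w' : α → ℝ}
    (h1 : ∑ i ∈ X, w i = ∑ i ∈ X, w' i) (h2 : ∑ i ∈ X, w i • p i = ∑ i ∈ X, w' i • p i) :
    ∀ i ∈ X, w i = w' i := by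
  intro i hi
  refine sub_eq_zero.1 (h (fun i => w i - w' i) ?_ ?_ i hi)
  · simp [h1]
  · simp [sub_smul, h2]

lemma openSimplex_congr {p p' : α → ℝ × ℝ} {X : Finset α} (h : ∀ i ∈ X, p' i = p i) :
    openSimplex p' X = openSimplex p X := by
  ext q
  simp only [openSimplex, Set.mem_ofPred_eq]
  refine exists_congr fun w => and_congr_right fun _ => and_congr_right fun _ => ?_
  rw [Finset.sum_congr rfl fun i hi => by rw [h i hi]]

lemma Indep.congr {p p' : α → ℝ × ℝ} {X : Finset α} (hX : Indep p X) (h : ∀ i ∈ X, p' i = p i) :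
    Indep p' X := by
  intro w h1 h2
  refine hX w h1 ?_
  rw [← h2]
  exact Finset.sum_congr rfl fun i hi => by rw [h i hi]

lemma barycenter_mem_openSimplex {p : α → ℝ × ℝ} {X : Finset α} {a : α}
    (hX : X.card = 3) (hp : p a = ∑ i ∈ X, (1 / 3 : ℝ) • p i) : p a ∈ openSimplex p X :=
  ⟨fun _ => 1 / 3, fun _ _ => by norm_num, by simp [hX], hp.symm⟩

variable [DecidableEq α]

/-- Adjacency in the graph that arises from the complete graph on `B` by joining each vertex `v`
of `s` to the vertices of `F v`. -/
def StackAdj (B : Finset α) (F : α → Finset α) (s : Finset α) (u v : α) : Prop :=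
  (u ∈ B ∧ v ∈ B ∧ u ≠ v) ∨ (v ∈ s ∧ u ∈ F v) ∨ (u ∈ s ∧ v ∈ F u)

/-- The triangle `B` and all triangles that arise when a vertex `c` of `s` is put into the
triangle `F c`. -/
def IsFace (B : Finset α) (F : α → Finset α) (s X : Finset α) : Prop :=
  X = B ∨ ∃ c ∈ s, ∃ a ∈ F c, X = insert c ((F c).erase a)

/-- A straight-line drawing in which the triangles that were not used so far are empty. -/
structure StackDrawing (B : Finset α) (F : α → Finset α) (s : Finset α) (p : α → ℝ × ℝ) :
    Prop where
  inj : Set.InjOn p (B ∪ s : Finset α)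
  vertex : ∀ u v w, StackAdj B F s u v → w ∈ B ∪ s → p w ∈ segment ℝ (p u) (p v) → w = u ∨ w = v
  cross : ∀ u v x y, StackAdj B F s u v → StackAdj B F s x y → s(u, v) ≠ s(x, y) →
    segment ℝ (p u) (p v) ∩ segment ℝ (p x) (p y) ⊆ p '' (({u, v} : Set α) ∩ {x, y})
  indep : ∀ X, IsFace B F s X → (∀ v ∈ s, F v ≠ X) → Indep p X
  vertex_notMem : ∀ X, IsFace B F s X → (∀ v ∈ s, F v ≠ X) → ∀ w ∈ B ∪ s, p w ∉ openSimplex p X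
  edge_notMem : ∀ X, IsFace B F s X → (∀ v ∈ s, F v ≠ X) → ∀ u v, StackAdj B F s u v →
    ∀ q ∈ segment ℝ (p u) (p v), q ∉ openSimplex p X
  disjoint : ∀ X Y, IsFace B F s X → (∀ v ∈ s, F v ≠ X) → IsFace B F s Y → (∀ v ∈ s, F v ≠ Y) →
    X ≠ Y → ∀ q ∈ openSimplex p X, q ∉ openSimplex p Y

section

variable {B : Finset α} {F : α → Finset α} {s : Finset α}

lemma StackAdj.mem (hF : ∀ v ∈ s, F v ⊆ B ∪ s) {u v : α} (h : StackAdj B F s u v) :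
    u ∈ B ∪ s ∧ v ∈ B ∪ s := by
  rcases h with ⟨h1, h2, -⟩ | ⟨h1, h2⟩ | ⟨h1, h2⟩
  · exact ⟨Finset.mem_union_left _ h1, Finset.mem_union_left _ h2⟩
  · exact ⟨hF _ h1 h2, Finset.mem_union_right _ h1⟩
  · exact ⟨Finset.mem_union_right _ h1, hF _ h1 h2⟩

lemma IsFace.subset (hF : ∀ v ∈ s, F v ⊆ B ∪ s) {X : Finset α} (h : IsFace B F s X) :
    X ⊆ B ∪ s := by
  rcases h with rfl | ⟨c, hc, a, -, rfl⟩
  · exact Finset.subset_union_left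
  · exact Finset.insert_subset (Finset.mem_union_right _ hc)
      ((Finset.erase_subset _ _).trans (hF c hc))

lemma StackDrawing.congr {p p' : α → ℝ × ℝ} (D : StackDrawing B F s p)
    (hF : ∀ v ∈ s, F v ⊆ B ∪ s) (h : ∀ i ∈ B ∪ s, p' i = p i) : StackDrawing B F s p' where
  inj := by
    intro x hx y hy hxy
    rw [h x hx, h y hy] at hxy
    exact D.inj hx hy hxy
  vertex u v w huv hw hm := by
    rw [h _ (huv.mem hF).1, h _ (huv.mem hF).2, h _ hw] at hm
    exact D.vertex u v w huv hw hm
  cross u v x y huv hxy hne := by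
    rw [h _ (huv.mem hF).1, h _ (huv.mem hF).2, h _ (hxy.mem hF).1, h _ (hxy.mem hF).2]
    refine (D.cross u v x y huv hxy hne).trans ?_
    rintro _ ⟨z, hz, rfl⟩
    refine ⟨z, hz, h z ?_⟩
    rcases hz.1 with rfl | rfl
    · exact (huv.mem hF).1
    · exact (huv.mem hF).2
  indep X hX hX' := (D.indep X hX hX').congr fun i hi => h i (hX.subset hF hi)
  vertex_notMem X hX hX' w hw := by
    rw [openSimplex_congr fun i hi => h i (hX.subset hF hi), h w hw]
    exact D.vertex_notMem X hX hX' w hw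
  edge_notMem X hX hX' u v huv := by
    rw [openSimplex_congr fun i hi => h i (hX.subset hF hi), h _ (huv.mem hF).1,
      h _ (huv.mem hF).2]
    exact D.edge_notMem X hX hX' u v huv
  disjoint X Y hX hX' hY hY' := by
    rw [openSimplex_congr fun i hi => h i (hX.subset hF hi),
      openSimplex_congr fun i hi => h i (hY.subset hF hi)]
    exact D.disjoint X Y hX hX' hY hY'

/-- Weights on a triangle at the barycenter of `X`, rewritten as weights on `X`. -/
lemma sum_insert_barycenter {p : α → ℝ × ℝ} {X : Finset α} {a b : α} (ha : a ∉ X) (hb : b ∈ X)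
    (hX : X.card = 3) (hp : p a = ∑ i ∈ X, (1 / 3 : ℝ) • p i) (w : α → ℝ) :
    (∑ i ∈ insert a (X.erase b), w i = ∑ i ∈ X, ((if i = b then 0 else w i) + w a / 3)) ∧
    (∑ i ∈ insert a (X.erase b), w i • p i =
      ∑ i ∈ X, ((if i = b then 0 else w i) + w a / 3) • p i) := by
  have ha' : a ∉ X.erase b := fun h => ha (Finset.mem_of_mem_erase h)
  rw [Finset.sum_insert ha', Finset.sum_insert ha']
  constructor
  · rw [Finset.sum_add_distrib, Finset.sum_const, hX, ← Finset.add_sum_erase X _ hb, if_pos rfl,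
      Finset.sum_congr rfl fun i hi => if_neg (Finset.ne_of_mem_erase hi)]
    simp only [nsmul_eq_mul]
    push_cast
    ring
  · simp only [add_smul]
    rw [Finset.sum_add_distrib, ← Finset.add_sum_erase X
      (fun i => (if i = b then (0 : ℝ) else w i) • p i) hb, if_pos rfl,
      Finset.sum_congr rfl (fun i hi => by rw [if_neg (Finset.ne_of_mem_erase hi)] :
        ∀ i ∈ X.erase b, (if i = b then (0 : ℝ) else w i) • p i = w i • p i), hp,
      Finset.smul_sum, zero_smul, zero_add, add_comm]
    congr 1
    refine Finset.sum_congr rfl fun i _ => ?_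
    rw [smul_smul]
    ring_nf

/-- In barycentric coordinates of `X`, the part of the triangle opposite to `b`, seen from the
barycenter, is where the weight of `b` is strictly smallest. This makes the three parts disjoint. -/
lemma exists_weights_of_mem_openSimplex_insert {p : α → ℝ × ℝ} {X : Finset α} {a b : α}
    (ha : a ∉ X) (hb : b ∈ X) (hX : X.card = 3) (hp : p a = ∑ i ∈ X, (1 / 3 : ℝ) • p i)
    {q : ℝ × ℝ} (hq : q ∈ openSimplex p (insert a (X.erase b))) :
    ∃ w : α → ℝ, (∀ i ∈ X, 0 < w i) ∧ ∑ i ∈ X, w i = 1 ∧ ∑ i ∈ X, w i • p i = q ∧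
      ∀ i ∈ X, i ≠ b → w b < w i := by
  obtain ⟨w, h1, h2, h3⟩ := hq
  obtain ⟨e1, e2⟩ := sum_insert_barycenter ha hb hX hp w
  have h0 := h1 a (Finset.mem_insert_self _ _)
  have h4 : ∀ i ∈ X, i ≠ b → 0 < w i := fun i hi hib =>
    h1 i (Finset.mem_insert_of_mem (Finset.mem_erase.2 ⟨hib, hi⟩))
  refine ⟨fun i => (if i = b then 0 else w i) + w a / 3, fun i hi => ?_, by rw [← e1, h2],
    by rw [← e2, h3], fun i hi hib => ?_⟩
  · by_cases hib : i = b
    · simp only [if_pos hib]; linarith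
    · have := h4 i hi hib
      simp only [if_neg hib]; linarith
  · have := h4 i hi hib
    simp only [if_neg hib, if_true]; linarith

lemma openSimplex_insert_subset {p : α → ℝ × ℝ} {X : Finset α} {a b : α}
    (ha : a ∉ X) (hb : b ∈ X) (hX : X.card = 3) (hp : p a = ∑ i ∈ X, (1 / 3 : ℝ) • p i) :
    openSimplex p (insert a (X.erase b)) ⊆ openSimplex p X := fun _ hq => by
  obtain ⟨w, h1, h2, h3, -⟩ := exists_weights_of_mem_openSimplex_insert ha hb hX hp hq
  exact ⟨w, h1, h2, h3⟩

lemma Indep.insert_barycenter {p : α → ℝ × ℝ} {X : Finset α} {a b : α}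
    (ha : a ∉ X) (hb : b ∈ X) (hX : X.card = 3) (hp : p a = ∑ i ∈ X, (1 / 3 : ℝ) • p i)
    (h : Indep p X) : Indep p (insert a (X.erase b)) := by
  intro w h1 h2
  obtain ⟨e1, e2⟩ := sum_insert_barycenter ha hb hX hp w
  have h3 := h _ (e1.symm.trans h1) (e2.symm.trans h2)
  have h0 : w a = 0 := by
    have := h3 b hb
    simp only [if_true] at this
    linarith
  intro i hi
  rcases Finset.mem_insert.1 hi with rfl | hi
  · exact h0
  · have := h3 i (Finset.mem_of_mem_erase hi)
    rw [if_neg (Finset.ne_of_mem_erase hi), h0] at this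
    linarith

/-- On the segment from the barycenter to the corner `b` the other two weights agree and do not
exceed that of `b`. So no weight is strictly smallest, and the segment avoids all three open parts.
-/
lemma exists_weights_of_mem_segment {p : α → ℝ × ℝ} {X : Finset α} {a b : α} (hb : b ∈ X)
    (hX : X.card = 3) (hp : p a = ∑ i ∈ X, (1 / 3 : ℝ) • p i) {q : ℝ × ℝ}
    (hq : q ∈ segment ℝ (p a) (p b)) :
    ∃ r : ℝ, 0 ≤ r ∧ r ≤ 1 / 3 ∧ ∑ i ∈ X, (if i = b then 1 - 2 * r else r) = 1 ∧
      ∑ i ∈ X, (if i = b then 1 - 2 * r else r) • p i = q ∧ (r = 0 → q = p b) ∧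
      (r = 1 / 3 → q = p a) := by
  obtain ⟨x, y, hx, hy, hxy, rfl⟩ := hq
  have hy' : y = 1 - x := by linarith
  subst hy'
  refine ⟨x / 3, by positivity, by linarith, ?_, ?_, fun h => ?_, fun h => ?_⟩
  · rw [← Finset.add_sum_erase X _ hb, if_pos rfl,
      Finset.sum_congr rfl fun i hi => if_neg (Finset.ne_of_mem_erase hi), Finset.sum_const,
      Finset.card_erase_of_mem hb, hX]
    simp only [nsmul_eq_mul]
    push_cast
    ring
  · rw [hp, Finset.smul_sum, ← Finset.add_sum_erase X _ hb, ← Finset.add_sum_erase X _ hb,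
      if_pos rfl, Finset.sum_congr rfl (fun i hi => by rw [if_neg (Finset.ne_of_mem_erase hi)] :
        ∀ i ∈ X.erase b, (if i = b then 1 - 2 * (x / 3) else x / 3) • p i = (x / 3) • p i),
      Finset.sum_congr rfl (fun i _ => by rw [smul_smul, mul_one_div] :
        ∀ i ∈ X.erase b, x • (1 / 3 : ℝ) • p i = (x / 3) • p i)]
    module
  · have : x = 0 := by linarith
    simp [this]
  · have : x = 1 := by linarith
    simp [this]

lemma mem_openSimplex_of_mem_segment {p : α → ℝ × ℝ} {X : Finset α} {a b : α} (hb : b ∈ X)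
    (hX : X.card = 3) (hp : p a = ∑ i ∈ X, (1 / 3 : ℝ) • p i) {q : ℝ × ℝ}
    (hq : q ∈ segment ℝ (p a) (p b)) (hqb : q ≠ p b) : q ∈ openSimplex p X := by
  obtain ⟨r, h1, h2, h3, h4, h5, -⟩ := exists_weights_of_mem_segment hb hX hp hq
  have h0 : 0 < r := lt_of_le_of_ne h1 fun h => hqb (h5 h.symm)
  refine ⟨_, fun i _ => ?_, h3, h4⟩
  split_ifs <;> linarith

lemma segment_notMem_openSimplex_insert {p : α → ℝ × ℝ} {X : Finset α} {a b c : α}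
    (ha : a ∉ X) (hb : b ∈ X) (hc : c ∈ X) (hX : X.card = 3)
    (hp : p a = ∑ i ∈ X, (1 / 3 : ℝ) • p i) (h : Indep p X) {q : ℝ × ℝ}
    (hq : q ∈ segment ℝ (p a) (p b)) : q ∉ openSimplex p (insert a (X.erase c)) := by
  intro hq'
  obtain ⟨r, h1, h2, h3, h4, -⟩ := exists_weights_of_mem_segment hb hX hp hq
  obtain ⟨w, g1, g2, g3, g4⟩ := exists_weights_of_mem_openSimplex_insert ha hc hX hp hq'
  have he := h.weights_eq (h3.trans g2.symm) (h4.trans g3.symm)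
  obtain ⟨d, hd, hdb, hdc⟩ : ∃ d ∈ X, d ≠ b ∧ d ≠ c := by
    obtain ⟨d, hd, hd'⟩ := Finset.exists_mem_notMem_of_card_lt_card
      (show ({b, c} : Finset α).card < X.card by
        rw [hX]; exact (Finset.card_le_two).trans_lt (by norm_num))
    exact ⟨d, hd, by simpa [not_or] using hd'⟩
  have e1 := g4 d hd hdc
  rw [← he d hd, ← he c hc, if_neg hdb] at e1
  split_ifs at e1 <;> linarith

lemma disjoint_openSimplex_insert {p : α → ℝ × ℝ} {X : Finset α} {a b c : α}
    (ha : a ∉ X) (hb : b ∈ X) (hc : c ∈ X) (hbc : b ≠ c) (hX : X.card = 3)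
    (hp : p a = ∑ i ∈ X, (1 / 3 : ℝ) • p i) (h : Indep p X) {q : ℝ × ℝ}
    (hq : q ∈ openSimplex p (insert a (X.erase b))) :
    q ∉ openSimplex p (insert a (X.erase c)) := by
  intro hq'
  obtain ⟨w, h1, h2, h3, h4⟩ := exists_weights_of_mem_openSimplex_insert ha hb hX hp hq
  obtain ⟨w', g1, g2, g3, g4⟩ := exists_weights_of_mem_openSimplex_insert ha hc hX hp hq'
  have he := h.weights_eq (h2.trans g2.symm) (h3.trans g3.symm)
  have e1 := h4 c hc hbc.symm
  have e2 := g4 b hb hbc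
  rw [← he b hb, ← he c hc] at e2
  exact lt_asymm e1 e2

lemma eq_barycenter_of_mem_segment {p : α → ℝ × ℝ} {X : Finset α} {a b c : α}
    (hb : b ∈ X) (hc : c ∈ X) (hbc : b ≠ c) (hX : X.card = 3)
    (hp : p a = ∑ i ∈ X, (1 / 3 : ℝ) • p i) (h : Indep p X) {q : ℝ × ℝ}
    (hq : q ∈ segment ℝ (p a) (p b)) (hq' : q ∈ segment ℝ (p a) (p c)) : q = p a := by
  obtain ⟨r, h1, h2, h3, h4, -, h5⟩ := exists_weights_of_mem_segment hb hX hp hq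
  obtain ⟨r', g1, g2, g3, g4, -⟩ := exists_weights_of_mem_segment hc hX hp hq'
  have he := h.weights_eq (h3.trans g3.symm) (h4.trans g4.symm)
  have e1 := he b hb
  have e2 := he c hc
  rw [if_pos rfl, if_neg hbc] at e1
  rw [if_pos rfl, if_neg hbc.symm] at e2
  exact h5 (by linarith)

lemma stackAdj_insert {a : α} {u v : α}
    (h : StackAdj B F (insert a s) u v) :
    StackAdj B F s u v ∨ (u ∈ F a ∧ v = a) ∨ (u = a ∧ v ∈ F a) := by
  rcases h with h | ⟨h, h'⟩ | ⟨h, h'⟩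
  · exact Or.inl (Or.inl h)
  · rcases Finset.mem_insert.1 h with rfl | h
    · exact Or.inr (Or.inl ⟨h', rfl⟩)
    · exact Or.inl (Or.inr (Or.inl ⟨h, h'⟩))
  · rcases Finset.mem_insert.1 h with rfl | h
    · exact Or.inr (Or.inr ⟨rfl, h'⟩)
    · exact Or.inl (Or.inr (Or.inr ⟨h, h'⟩))

lemma isFace_insert {a : α} {X : Finset α} (h : IsFace B F (insert a s) X) :
    IsFace B F s X ∨ ∃ b ∈ F a, X = insert a ((F a).erase b) := by
  rcases h with h | ⟨c, hc, b, hb, h⟩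
  · exact Or.inl (Or.inl h)
  · rcases Finset.mem_insert.1 hc with rfl | hc
    · exact Or.inr ⟨b, hb, h⟩
    · exact Or.inl (Or.inr ⟨c, hc, b, hb, h⟩)

/-- Apart from their old ends, the new edges lie in an open triangle that no old vertex or edge
meets. The new faces lie in that triangle as well, so only the new edges and faces need to be
compared with each other, which barycentric coordinates do. -/
lemma StackDrawing.insert_barycenter {p : α → ℝ × ℝ} (D : StackDrawing B F s p) {a : α}
    (ha : a ∉ B ∪ s) (hF : ∀ v ∈ s, F v ⊆ B ∪ s) (hface : IsFace B F s (F a))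
    (hnew : ∀ v ∈ s, F v ≠ F a) (hX : (F a).card = 3)
    (hp : p a = ∑ i ∈ F a, (1 / 3 : ℝ) • p i) : StackDrawing B F (insert a s) p := by
  have hFa : F a ⊆ B ∪ s := hface.subset hF
  have haF : a ∉ F a := fun h => ha (hFa h)
  have hind : Indep p (F a) := D.indep _ hface hnew
  have hpa : p a ∈ openSimplex p (F a) := barycenter_mem_openSimplex hX hp
  have hpne : ∀ w ∈ B ∪ s, p w ≠ p a := fun w hw h =>
    D.vertex_notMem _ hface hnew w hw (h ▸ hpa)
  have hvert : ∀ b ∈ F a, ∀ w ∈ B ∪ s, p w ∈ segment ℝ (p a) (p b) → w = b := by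
    intro b hb w hw h
    by_contra hne
    exact D.vertex_notMem _ hface hnew w hw (mem_openSimplex_of_mem_segment hb hX hp h
      fun h => hne (D.inj hw (hFa hb) h))
  have hcross : ∀ b ∈ F a, ∀ u v, StackAdj B F s u v → ∀ q ∈ segment ℝ (p a) (p b),
      q ∈ segment ℝ (p u) (p v) → q = p b ∧ (b = u ∨ b = v) := by
    intro b hb u v huv q hq hq'
    have h1 : q = p b := by
      by_contra hne
      exact D.edge_notMem _ hface hnew u v huv q hq' (mem_openSimplex_of_mem_segment hb hX hp hq hne)
    rw [h1] at hq'
    exact ⟨h1, D.vertex u v b huv (hFa hb) hq'⟩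
  have hopen : ∀ X, IsFace B F (insert a s) X → (∀ v ∈ insert a s, F v ≠ X) →
      (IsFace B F s X ∧ (∀ v ∈ s, F v ≠ X) ∧ F a ≠ X) ∨ ∃ b ∈ F a, X = insert a ((F a).erase b) := by
    intro X h h'
    rcases isFace_insert h with h1 | h1
    · exact Or.inl ⟨h1, fun v hv => h' v (Finset.mem_insert_of_mem hv),
        h' a (Finset.mem_insert_self _ _)⟩
    · exact Or.inr h1
  have hmem : ∀ {w}, w ∈ B ∪ insert a s → w = a ∨ w ∈ B ∪ s := by
    intro w hw
    rwa [Finset.union_insert, Finset.mem_insert] at hw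
  constructor
  · intro x hx y hy hxy
    rcases hmem hx with hx' | hx' <;> rcases hmem hy with hy' | hy'
    · rw [hx', hy']
    · exact absurd (by rw [← hxy, hx']) (hpne _ hy')
    · exact absurd (by rw [hxy, hy']) (hpne _ hx')
    · exact D.inj hx' hy' hxy
  · intro u v w huv hw h
    rcases stackAdj_insert huv with huv | ⟨hu, rfl⟩ | ⟨rfl, hv⟩
    · rcases hmem hw with hwa | hw
      · rw [hwa] at h
        exact absurd hpa (D.edge_notMem _ hface hnew u v huv _ h)
      · exact D.vertex u v w huv hw h
    · rcases hmem hw with hw | hw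
      · exact Or.inr hw
      · exact Or.inl (hvert _ hu _ hw (by rwa [segment_symm]))
    · rcases hmem hw with hw | hw
      · exact Or.inl hw
      · exact Or.inr (hvert _ hv _ hw h)
  · have key : ∀ b ∈ F a, ∀ x y, StackAdj B F (insert a s) x y → s(a, b) ≠ s(x, y) →
        segment ℝ (p a) (p b) ∩ segment ℝ (p x) (p y) ⊆ p '' (({a, b} : Set α) ∩ {x, y}) := by
      rintro b hb x y hxy hne q ⟨hq, hq'⟩
      rcases stackAdj_insert hxy with hxy | ⟨hx, rfl⟩ | ⟨rfl, hy⟩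
      · obtain ⟨h1, h2⟩ := hcross b hb x y hxy q hq hq'
        exact ⟨b, ⟨Or.inr rfl, h2⟩, h1.symm⟩
      · have hbx : b ≠ x := by
          rintro rfl
          exact hne Sym2.eq_swap
        rw [segment_symm] at hq'
        exact ⟨y, ⟨Or.inl rfl, Or.inr rfl⟩, (eq_barycenter_of_mem_segment hb hx hbx hX hp hind hq hq').symm⟩
      · have hby : b ≠ y := by
          rintro rfl
          exact hne rfl
        exact ⟨x, ⟨Or.inl rfl, Or.inl rfl⟩, (eq_barycenter_of_mem_segment hb hy hby hX hp hind hq hq').symm⟩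
    intro u v x y huv hxy hne
    have hmono : ∀ {u v}, StackAdj B F s u v → StackAdj B F (insert a s) u v := fun h =>
      Or.imp_right (Or.imp (And.imp_left Finset.mem_insert_of_mem)
        (And.imp_left Finset.mem_insert_of_mem)) h
    rcases stackAdj_insert huv with huv' | ⟨hu, rfl⟩ | ⟨rfl, hv⟩
    · rcases stackAdj_insert hxy with hxy' | ⟨hx, rfl⟩ | ⟨rfl, hy⟩
      · exact D.cross u v x y huv' hxy' hne
      · rw [Set.inter_comm, Set.inter_comm ({u, v} : Set α), segment_symm, Set.pair_comm x]
        exact key x hx u v (hmono huv') (by rwa [Sym2.eq_swap, ne_comm])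
      · rw [Set.inter_comm, Set.inter_comm ({u, v} : Set α)]
        exact key y hy u v (hmono huv') hne.symm
    · rw [segment_symm, Set.pair_comm]
      exact key u hu x y hxy (by rwa [Sym2.eq_swap])
    · exact key v hv x y hxy hne
  · intro X h h'
    rcases hopen X h h' with ⟨h1, h2, -⟩ | ⟨b, hb, rfl⟩
    · exact D.indep X h1 h2
    · exact hind.insert_barycenter haF hb hX hp
  · intro X h h' w hw
    rcases hopen X h h' with ⟨h1, h2, h3⟩ | ⟨b, hb, rfl⟩
    · rcases hmem hw with rfl | hw
      · exact D.disjoint _ _ hface hnew h1 h2 h3 _ hpa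
      · exact D.vertex_notMem X h1 h2 w hw
    · rcases hmem hw with rfl | hw
      · exact segment_notMem_openSimplex_insert haF hb hb hX hp hind (left_mem_segment _ _ _)
      · exact fun h => D.vertex_notMem _ hface hnew w hw (openSimplex_insert_subset haF hb hX hp h)
  · intro X h h' u v huv q hq
    have key : ∀ c ∈ F a, ∀ q ∈ segment ℝ (p a) (p c), q ∉ openSimplex p X := by
      intro c hc q hq
      rcases hopen X h h' with ⟨h1, h2, h3⟩ | ⟨b, hb, rfl⟩
      · by_cases hqc : q = p c
        · rw [hqc]
          exact D.vertex_notMem X h1 h2 c (hFa hc)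
        · exact D.disjoint _ _ hface hnew h1 h2 h3 _
            (mem_openSimplex_of_mem_segment hc hX hp hq hqc)
      · exact segment_notMem_openSimplex_insert haF hc hb hX hp hind hq
    rcases stackAdj_insert huv with huv | ⟨hu, rfl⟩ | ⟨rfl, hv⟩
    · rcases hopen X h h' with ⟨h1, h2, -⟩ | ⟨b, hb, rfl⟩
      · exact D.edge_notMem X h1 h2 u v huv q hq
      · exact fun h => D.edge_notMem _ hface hnew u v huv q hq
          (openSimplex_insert_subset haF hb hX hp h)
    · exact key u hu q (by rwa [segment_symm])
    · exact key v hv q hq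
  · intro X Y h h' g g' hXY q hq hq'
    rcases hopen X h h' with ⟨h1, h2, h3⟩ | ⟨b, hb, rfl⟩ <;>
      rcases hopen Y g g' with ⟨g1, g2, g3⟩ | ⟨c, hc, rfl⟩
    · exact D.disjoint X Y h1 h2 g1 g2 hXY q hq hq'
    · exact D.disjoint _ _ hface hnew h1 h2 h3 q (openSimplex_insert_subset haF hc hX hp hq') hq
    · exact D.disjoint _ _ hface hnew g1 g2 g3 q (openSimplex_insert_subset haF hb hX hp hq) hq'
    · exact disjoint_openSimplex_insert haF hb hc (fun h => hXY (by rw [h])) hX hp hind hq hq'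

lemma Indep.exists_weights_of_mem_segment {p : α → ℝ × ℝ} {X : Finset α} {u v : α} (hu : u ∈ X)
    (hv : v ∈ X) {q : ℝ × ℝ} (hq : q ∈ segment ℝ (p u) (p v)) :
    ∃ w : α → ℝ, ∑ i ∈ X, w i = 1 ∧ ∑ i ∈ X, w i • p i = q ∧ ∀ i, i ≠ u → i ≠ v → w i = 0 := by
  obtain ⟨x, y, -, -, hxy, rfl⟩ := hq
  refine ⟨fun i => (if i = u then x else 0) + if i = v then y else 0, ?_, ?_, fun i h1 h2 => ?_⟩
  · simp [Finset.sum_add_distrib, hu, hv, hxy]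
  · simp [Finset.sum_add_distrib, add_smul, ite_smul, hu, hv]
  · simp [h1, h2]

lemma exists_common_of_card_eq_three {X : Finset α} (hX : X.card = 3) {u v a b : α} (hu : u ∈ X)
    (hv : v ∈ X) (ha : a ∈ X) (hb : b ∈ X) (huv : u ≠ v) (hab : a ≠ b)
    (hne : s(u, v) ≠ s(a, b)) : ∃ d ∈ X, d ∈ ({u, v} : Set α) ∩ {a, b} ∧
      ∀ i ∈ X, i ≠ d → (i ≠ u ∧ i ≠ v) ∨ (i ≠ a ∧ i ≠ b) := by
  rw [ne_eq, Sym2.eq_iff] at hne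
  by_cases h1 : a = u ∨ a = v
  · exact ⟨a, ha, ⟨h1, Or.inl rfl⟩, fun i _ hia => by grind⟩
  by_cases h2 : b = u ∨ b = v
  · exact ⟨b, hb, ⟨h2, Or.inr rfl⟩, fun i _ hia => by grind⟩
  have h3 : ({u, v, a, b} : Finset α) ⊆ X := by
    simp only [Finset.insert_subset_iff, Finset.singleton_subset_iff]
    exact ⟨hu, hv, ha, hb⟩
  have h4 := Finset.card_le_card h3
  push Not at h1 h2
  rw [hX, Finset.card_insert_of_notMem (by simp [huv, h1.1.symm, h2.1.symm]),
    Finset.card_insert_of_notMem (by simp [h1.2.symm, h2.2.symm]), Finset.card_pair hab] at h4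
  omega

lemma exists_indep {X : Finset α} (hX : X.card = 3) : ∃ p, Indep p X := by
  obtain ⟨x, y, z, hxy, hxz, hyz, rfl⟩ := Finset.card_eq_three.1 hX
  refine ⟨fun i => if i = x then (0, 0) else if i = y then (1, 0) else (0, 1),
    fun w h1 h2 => ?_⟩
  rw [Finset.sum_insert (by simp [hxy, hxz]), Finset.sum_pair hyz] at h1 h2
  simp only [if_true, hxy.symm, hxz.symm, hyz.symm, if_false] at h2
  simp only [Prod.smul_mk, smul_eq_mul, Prod.mk_add_mk, Prod.mk_eq_zero] at h2
  simp only [Finset.mem_insert, Finset.mem_singleton, forall_eq_or_imp, forall_eq]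
  refine ⟨?_, ?_, ?_⟩ <;> linarith [h2.1, h2.2]

lemma exists_stackDrawing_empty (hB : B.card = 3) : ∃ p, StackDrawing B F ∅ p := by
  obtain ⟨p, hind⟩ := exists_indep hB
  have hthird : ∀ u v, ∃ d ∈ B, d ≠ u ∧ d ≠ v := by
    intro u v
    obtain ⟨d, hd, hd'⟩ := Finset.exists_mem_notMem_of_card_lt_card
      (show ({u, v} : Finset α).card < B.card by
        rw [hB]; exact (Finset.card_le_two).trans_lt (by norm_num))
    exact ⟨d, hd, by simpa [not_or] using hd'⟩
  have hseg : ∀ u ∈ B, ∀ v ∈ B,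
      ∀ q ∈ segment ℝ (p u) (p v), q ∉ openSimplex p B := by
    rintro u hu v hv q hq ⟨w', g1, g2, g3⟩
    obtain ⟨w, h1, h2, h3⟩ := Indep.exists_weights_of_mem_segment hu hv hq
    obtain ⟨d, hd, hd1, hd2⟩ := hthird u v
    have := hind.weights_eq (h1.trans g2.symm) (h2.trans g3.symm) d hd
    rw [h3 d hd1 hd2] at this
    exact (g1 d hd).ne this
  have hvert : ∀ u ∈ B, ∀ v ∈ B,
      ∀ w ∈ B, p w ∈ segment ℝ (p u) (p v) → w = u ∨ w = v := by
    intro u hu v hv w hw hq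
    by_contra! hne
    obtain ⟨c, h1, h2, h3⟩ := Indep.exists_weights_of_mem_segment hu hv hq
    obtain ⟨c', g1, g2, g3⟩ := Indep.exists_weights_of_mem_segment hw hw (left_mem_segment ℝ (p w) (p w))
    have he := hind.weights_eq (h1.trans g1.symm) (h2.trans g2.symm)
    have : ∑ i ∈ B, c' i = 0 := by
      refine Finset.sum_eq_zero fun i hi => ?_
      by_cases hiw : i = w
      · rw [← he i hi, h3 i (by rw [hiw]; exact hne.1) (by rw [hiw]; exact hne.2)]
      · exact g3 i hiw hiw
    linarith
  have hadj : ∀ {u v}, StackAdj B F ∅ u v →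
      u ∈ B ∧ v ∈ B ∧ u ≠ v := by
    intro u v h
    simpa [StackAdj] using h
  have hface : ∀ {X}, IsFace B F ∅ X → X = B := by
    intro X h
    simpa [IsFace] using h
  refine ⟨p, ?_, ?_, ?_, ?_, ?_, ?_, ?_⟩
  · intro u hu v hv huv
    rw [Finset.union_empty] at hu hv
    have := hvert v hv v hv u hu (by rw [huv]; exact left_mem_segment _ _ _)
    simpa using this
  · intro u v w huv hw h
    rw [Finset.union_empty] at hw
    exact hvert u (hadj huv).1 v (hadj huv).2.1 w hw h
  · rintro u v a b huv hab hne q ⟨hq, hq'⟩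
    obtain ⟨hu, hv, huv⟩ := hadj huv
    obtain ⟨ha, hb, hab⟩ := hadj hab
    obtain ⟨w, h1, h2, h3⟩ := Indep.exists_weights_of_mem_segment hu hv hq
    obtain ⟨w', g1, g2, g3⟩ := Indep.exists_weights_of_mem_segment ha hb hq'
    have he := hind.weights_eq (h1.trans g1.symm) (h2.trans g2.symm)
    obtain ⟨d, hd, hd', hd''⟩ := exists_common_of_card_eq_three hB hu hv ha hb huv hab hne
    refine ⟨d, hd', ?_⟩
    have h0 : ∀ i ∈ B, i ≠ d → w i = 0 := by
      intro i hi hid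
      rcases hd'' i hi hid with h | h
      · exact h3 i h.1 h.2
      · rw [he i hi, g3 i h.1 h.2]
    rw [Finset.sum_eq_single_of_mem d hd h0] at h1
    rw [Finset.sum_eq_single_of_mem d hd fun i hi hid => by rw [h0 i hi hid, zero_smul], h1,
      one_smul] at h2
    exact h2
  · intro X h _
    rw [hface h]
    exact hind
  · intro X h _ w hw
    rw [hface h]
    rw [Finset.union_empty] at hw
    exact hseg w hw w hw _ (left_mem_segment _ _ _)
  · intro X h _ u v huv
    rw [hface h]
    exact hseg u (hadj huv).1 v (hadj huv).2.1
  · intro X Y h _ g _ hne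
    exact absurd ((hface h).trans (hface g).symm) hne

end

/-- Repeatedly putting a vertex into an empty triangle, starting with the triangle `B`, gives a
plane graph. -/
theorem exists_stackDrawing {β : Type*} [LinearOrder β] {B : Finset α} {F : α → Finset α}
    (rank : α → β) (hB : B.card = 3) (s : Finset α) (hdisj : ∀ v ∈ s, v ∉ B)
    (hrank : ∀ v ∈ s, ∀ a ∈ F v, rank a < rank v) (hF : ∀ v ∈ s, F v ⊆ B ∪ s)
    (hcard : ∀ v ∈ s, (F v).card = 3) (hface : ∀ v ∈ s, IsFace B F s (F v))
    (hinj : Set.InjOn F s) : ∃ p, StackDrawing B F s p := by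
  -- A vertex of maximal rank is a corner of no `F v`, so without it all the `F v` are still faces;
  -- it can be placed last.
  induction s using Finset.induction_on_max_value rank with
  | empty => exact exists_stackDrawing_empty hB
  | insert a s has hmax ih =>
    have hlt : ∀ v ∈ insert a s, a ∉ F v := by
      intro v hv h
      have h1 := hrank v hv a h
      rcases Finset.mem_insert.1 hv with rfl | hv
      · exact lt_irrefl _ h1
      · exact absurd h1 (not_lt.2 (hmax v hv))
    have hsub : ∀ v ∈ insert a s, F v ⊆ B ∪ s := by
      intro v hv x hx
      have := hF v hv hx
      rw [Finset.union_insert, Finset.mem_insert] at this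
      rcases this with rfl | h
      · exact absurd hx (hlt v hv)
      · exact h
    have hface' : ∀ v ∈ insert a s, IsFace B F s (F v) := by
      intro v hv
      rcases isFace_insert (hface v hv) with h | ⟨b, hb, h⟩
      · exact h
      · exact absurd (h ▸ Finset.mem_insert_self _ _) (hlt v hv)
    have hm : ∀ {v}, v ∈ s → v ∈ insert a s := Finset.mem_insert_of_mem
    obtain ⟨p, D⟩ := ih (fun v hv => hdisj v (hm hv)) (fun v hv => hrank v (hm hv))
      (fun v hv => hsub v (hm hv)) (fun v hv => hcard v (hm hv)) (fun v hv => hface' v (hm hv))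
      (hinj.mono (by simp))
    have ha : a ∈ insert a s := Finset.mem_insert_self _ _
    have haB : a ∉ B ∪ s := by
      rw [Finset.mem_union, not_or]
      exact ⟨hdisj a ha, has⟩
    have hcongr : ∀ i ∈ B ∪ s, Function.update p a (∑ i ∈ F a, (1 / 3 : ℝ) • p i) i = p i := by
      intro i hi
      exact Function.update_of_ne (fun h => haB (by rwa [← h])) _ _
    refine ⟨_, (D.congr (fun v hv => hsub v (hm hv)) hcongr).insert_barycenter haB
      (fun v hv => hsub v (hm hv)) (hface' a ha) (fun v hv h => ?_) (hcard a ha) ?_⟩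
    · exact has (hinj (hm hv) ha h ▸ hv)
    · rw [Function.update_self]
      exact Finset.sum_congr rfl fun i hi => by rw [hcongr i (hsub a ha hi)]

lemma StackDrawing.isPlanar {B : Finset α} {F : α → Finset α} {s : Finset α} {p : α → ℝ × ℝ}
    (D : StackDrawing B F s p) {V : Type*} {G : SimpleGraph V} {f : V → α}
    (hf : Function.Injective f) (hmem : ∀ v, f v ∈ B ∪ s)
    (hadj : ∀ u v, G.Adj u v → StackAdj B F s (f u) (f v)) : G.IsPlanar := by
  refine ⟨fun v => p (f v), fun u v h => hf (D.inj (hmem u) (hmem v) h), fun u v w h hw => ?_,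
    fun u v x y h h' hne q hq => ?_⟩
  · exact (D.vertex _ _ _ (hadj u v h) (hmem w) hw).imp (fun h => hf h) (fun h => hf h)
  · have hne' : s(f u, f v) ≠ s(f x, f y) := fun h => hne (Sym2.map.injective hf (by simpa using h))
    obtain ⟨z, ⟨hz, hz'⟩, rfl⟩ := D.cross _ _ _ _ (hadj u v h) (hadj x y h') hne' hq
    rcases hz with rfl | rfl
    · exact ⟨u, ⟨Or.inl rfl, hz'.imp (fun h => hf h) (fun h => hf h)⟩, rfl⟩
    · exact ⟨v, ⟨Or.inr rfl, hz'.imp (fun h => hf h) (fun h => hf h)⟩, rfl⟩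

end Stacking

/-! ### Closed walks on a line and on a cycle -/

section Cyclic

open scoped Fin.CommRing

variable {k : ℕ} [NeZero k]

/-- A cycle without one point is still connected, so a property that no step away from `s` changes
is constant off `s`. -/
lemma iff_of_forall_iff_add_one {P : Fin k → Prop} (s : Fin k)
    (h : ∀ i, i ≠ s → i + 1 ≠ s → (P i ↔ P (i + 1))) {i j : Fin k} (hi : i ≠ s) (hj : j ≠ s) :
    P i ↔ P j := by
  have key : ∀ d : ℕ, 1 ≤ d → d < k → (P (s + (d : Fin k)) ↔ P (s + 1)) := by
    intro d hd
    induction d, hd using Nat.le_induction with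
    | base => intro _; simp
    | succ d hd ih =>
      intro hdk
      rw [← ih (by omega), Nat.cast_succ, ← add_assoc]
      have hne : ∀ e : ℕ, 1 ≤ e → e < k → s + (e : Fin k) ≠ s := by
        intro e he hek h0
        rw [add_eq_left, Fin.natCast_eq_zero] at h0
        exact absurd (Nat.le_of_dvd he h0) (by omega)
      refine (h _ (hne d hd (by omega)) ?_).symm
      have := hne (d + 1) (by omega) hdk
      rwa [Nat.cast_succ, ← add_assoc] at this
  have key' : ∀ i : Fin k, i ≠ s → (P i ↔ P (s + 1)) := by
    intro i hi
    have h1 : (i - s).val ≠ 0 := by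
      intro h0
      exact hi (sub_eq_zero.1 (Fin.ext (by simpa using h0)))
    have := key (i - s).val (by omega) (i - s).isLt
    rwa [Fin.cast_val_eq_self, add_sub_cancel] at this
  rw [key' i hi, key' j hj]

lemma iff_of_forall_iff_add_one' {P : Fin k → Prop} (h : ∀ i, P i ↔ P (i + 1)) (i j : Fin k) :
    P i ↔ P j := by
  have key : ∀ d : ℕ, (P (j + (d : Fin k)) ↔ P j) := by
    intro d
    induction d with
    | zero => simp
    | succ d ih => rw [← ih, Nat.cast_succ, ← add_assoc, ← h]
  have := key (i - j).val
  rwa [Fin.cast_val_eq_self, add_sub_cancel] at this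

/-- A closed walk along a line whose upward steps end in distinguished places, visited at most
once, stays between two neighbouring places. -/
lemma exists_level {h : Fin k → ℤ} {joint : Fin k → Prop} (hk : 2 ≤ k)
    (step : ∀ i, h (i + 1) = h i ∨ (h (i + 1) = h i + 1 ∧ joint (i + 1)) ∨
      (h i = h (i + 1) + 1 ∧ joint i))
    (uniq : ∀ i j, joint i → joint j → h i = h j → i = j) :
    ∃ T, ∀ i, h i = T ∨ (h i = T + 1 ∧ joint i) := by
  obtain ⟨m, -, hm⟩ := Finset.exists_max_image Finset.univ h Finset.univ_nonempty
  simp only [Finset.mem_univ, true_implies] at hm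
  -- The walk can enter or leave the heights `≥ c` only next to the joint at height `c`, which is
  -- visited at most once.
  have cut : ∀ c : ℤ, ∀ i s, joint s → h s = c → i ≠ s → i + 1 ≠ s → (c ≤ h i ↔ c ≤ h (i + 1)) := by
    intro c i s hs hsc h1 h2
    rcases step i with h3 | ⟨h3, h4⟩ | ⟨h3, h4⟩
    · rw [h3]
    · have : h (i + 1) ≠ c := fun h5 => h2 (uniq _ _ h4 hs (h5.trans hsc.symm))
      omega
    · have : h i ≠ c := fun h5 => h1 (uniq _ _ h4 hs (h5.trans hsc.symm))
      omega
  have cut' : ∀ c : ℤ, (∀ s, joint s → h s ≠ c) → ∀ i, (c ≤ h i ↔ c ≤ h (i + 1)) := by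
    intro c hc i
    rcases step i with h3 | ⟨h3, h4⟩ | ⟨h3, h4⟩
    · rw [h3]
    · have := hc _ h4
      omega
    · have := hc _ h4
      omega
  by_cases hall : ∀ i, h i = h m
  · exact ⟨h m, fun i => Or.inl (hall i)⟩
  push Not at hall
  obtain ⟨i₁, hi₁⟩ := hall
  have hi₁' := hm i₁
  obtain ⟨s, hs, hsm⟩ : ∃ s, joint s ∧ h s = h m := by
    by_contra! hno
    have := (iff_of_forall_iff_add_one' (cut' (h m) hno) m i₁).1 le_rfl
    omega
  have his : i₁ ≠ s := fun h0 => hi₁ (by rw [h0, hsm])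
  -- The top height is attained only at its joint `s`: off `s` the walk never reaches it, as `i₁`
  -- shows.
  have hlt : ∀ i, i ≠ s → h i < h m := by
    intro i hi
    have := iff_of_forall_iff_add_one s (fun i => cut (h m) i s hs hsm) hi his
    omega
  have hss : s + 1 ≠ s := by
    intro h0
    have h1 : ((1 : ℕ) : Fin k) = 0 := by
      rw [Nat.cast_one]
      exact add_eq_left.1 h0
    rw [Fin.natCast_eq_zero] at h1
    have := Nat.le_of_dvd one_pos h1
    omega
  -- Off the joint at height `h m - 1`, if there is one, the walk stays on the same side as `s`.
  have hge : ∀ i, h m - 1 ≤ h i := by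
    by_cases hex : ∃ s', joint s' ∧ h s' = h m - 1
    · obtain ⟨s', hs', hsm'⟩ := hex
      intro i
      by_cases hi : i = s'
      · rw [hi, hsm']
      · refine (iff_of_forall_iff_add_one s' (fun i => cut (h m - 1) i s' hs' hsm') hi
          (j := s) (fun h0 => ?_)).2 (by omega)
        rw [h0] at hsm
        omega
    · push Not at hex
      exact fun i => (iff_of_forall_iff_add_one' (cut' (h m - 1) hex) i s).2 (by omega)
  refine ⟨h m - 1, fun i => ?_⟩
  by_cases hi : i = s
  · exact Or.inr ⟨by rw [hi]; omega, by rwa [hi]⟩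
  · have h1 := hlt i hi
    have h2 := hge i
    exact Or.inl (by omega)

/-- The successor on `{0, …, k}`, read cyclically. -/
def nextPos (k j : ℕ) : ℕ := if j = k then 0 else j + 1

/-- A closed walk of length `k` along a cycle of length `k + 1` whose upward steps end in
distinguished places, visited at most once, stays between two neighbouring places. -/
lemma exists_position {f : Fin k → ℕ} {joint : Fin k → Prop} (hk : 2 ≤ k) (hf : ∀ i, f i ≤ k)
    (step : ∀ i, f (i + 1) = f i ∨ (f (i + 1) = nextPos k (f i) ∧ joint (i + 1)) ∨
      (f i = nextPos k (f (i + 1)) ∧ joint i))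
    (uniq : ∀ i j, joint i → joint j → f i = f j → i = j) :
    ∃ T ≤ k, ∀ i, f i = T ∨ (f i = nextPos k T ∧ joint i) := by
  -- A walk with `k` steps cannot cross all the `k + 1` gaps of the cycle, as each step crosses at
  -- most one.
  obtain ⟨c, hc, hcross⟩ : ∃ c ≤ k, ∀ i, ¬ (f i = c ∧ f (i + 1) = nextPos k c) ∧
      ¬ (f (i + 1) = c ∧ f i = nextPos k c) := by
    by_contra! hno
    have hno' : ∀ c : Fin (k + 1), ∃ i, (f i = c ∧ f (i + 1) = nextPos k c) ∨
        (f (i + 1) = c ∧ f i = nextPos k c) := by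
      intro c
      obtain ⟨i, hi⟩ := hno c (by omega)
      exact ⟨i, by tauto⟩
    choose g hg using hno'
    have hinj : Function.Injective g := by
      intro a b hab
      have h1 := hg a
      have h2 := hg b
      rw [hab] at h1
      have := a.isLt
      have := b.isLt
      apply Fin.ext
      unfold nextPos at h1 h2
      split_ifs at h1 h2 <;> omega
    have := Fintype.card_le_of_injective g hinj
    simp at this
  -- Cut open at the uncrossed gap after `c`, the cycle becomes a line: the positions beyond `c` are
  -- lowered by `k + 1`.
  obtain ⟨T, hT⟩ := exists_level (h := fun i => if f i ≤ c then (f i : ℤ) else f i - (k + 1))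
    (joint := joint) hk (fun i => by
      have h1 := hcross i
      have h2 := step i
      have h3 := hf i
      have h4 := hf (i + 1)
      unfold nextPos at h1 h2
      rcases h2 with h2 | ⟨h2, h5⟩ | ⟨h2, h5⟩
      · left; simp only [h2]
      · right; left
        refine ⟨?_, h5⟩
        split_ifs at * <;> omega
      · right; right
        refine ⟨?_, h5⟩
        split_ifs at * <;> omega)
    (fun i j hi hj hij => uniq i j hi hj (by
      have h3 := hf i
      have h4 := hf j
      split_ifs at hij <;> omega))
  -- Otherwise all places of the walk would be joints at the same height, hence all equal.
  obtain ⟨i₀, hi₀⟩ : ∃ i, (if f i ≤ c then (f i : ℤ) else f i - (k + 1)) = T := by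
    by_contra! hno
    have h1 : ∀ i, _ := fun i => (hT i).resolve_left (hno i)
    have h2 : ∀ i j : Fin k, i = j := fun i j => uniq i j (h1 i).2 (h1 j).2 (by
      have h3 := hf i
      have h4 := hf j
      have := (h1 i).1.trans (h1 j).1.symm
      split_ifs at this <;> omega)
    have := h2 ⟨0, by omega⟩ ⟨1, by omega⟩
    simp at this
  refine ⟨f i₀, hf i₀, fun i => ?_⟩
  have h3 := hf i
  have h4 := hf i₀
  unfold nextPos
  rcases hT i with h1 | ⟨h1, h2⟩
  · left
    split_ifs at hi₀ h1 <;> omega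
  · right
    refine ⟨?_, h2⟩
    split_ifs at hi₀ h1 ⊢ <;> omega

-- Each vertex is on two edges of the cycle, so `t` core vertices cover at most `2 t` of its `k`
-- edges.
open scoped Classical in
lemma le_two_mul_add_of_cover {core : Fin k → Prop} {t c : ℕ}
    (ht : (Finset.univ.filter core).card ≤ t)
    (hc : (Finset.univ.filter fun i => ¬ core i ∧ ¬ core (i + 1)).card ≤ c) : k ≤ 2 * t + c := by
  have h1 : (Finset.univ.filter fun i => core (i + 1)).card ≤ (Finset.univ.filter core).card :=
    Finset.card_le_card_of_injOn (· + 1) (fun i hi => by simpa using hi)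
      (fun i _ j _ h => add_right_cancel h)
  have h2 : (Finset.univ : Finset (Fin k)) ⊆ Finset.univ.filter core ∪
      ((Finset.univ.filter fun i => core (i + 1)) ∪
        Finset.univ.filter fun i => ¬ core i ∧ ¬ core (i + 1)) := by
    intro i _
    simp only [Finset.mem_union, Finset.mem_filter, Finset.mem_univ, true_and]
    tauto
  have h3 := (Finset.card_le_card h2).trans (Finset.card_union_le _ _)
  have h4 := Finset.card_union_le (Finset.univ.filter fun i => core (i + 1))
    (Finset.univ.filter fun i => ¬ core i ∧ ¬ core (i + 1))
  rw [Finset.card_univ, Fintype.card_fin] at h3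
  omega

end Cyclic

/-! ### Blocks and rings -/

/-- The vertices of a block are named `0, 1, 2, …`; this is the triangle into which the vertex
`i ≥ 3` is put. The vertices `0, 1, 3, 4, …, t` form the core of the block. -/
def parent (t i : ℕ) : Finset ℕ :=
  if i ≤ t + 1 then {0, 1, i - 1}
  else {(i - (t + 2)) % 2, t - 1 - (i - (t + 2)) / 2, t - (i - (t + 2)) / 2}

/-- The blocks `J = 1, 2, …` are arranged in rings of `k + 1` blocks each, consecutive ones having
a vertex in common. All rings pass through the hub `(0, 0)`. This is the vertex of the block `J`
with name `i`. -/
def place (k J : ℕ) : ℕ → ℕ × ℕ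
  | 0 => if J % (k + 1) = 1 then (0, 0) else (J - 1, 1)
  | 1 => if J % (k + 1) = 0 then (0, 0) else (J, 1)
  | i + 2 => (J, i + 2)

/-- The triangle into which the vertex `v` is put. -/
def tri (k t : ℕ) (v : ℕ × ℕ) : Finset (ℕ × ℕ) :=
  if v.2 = 1 then {(0, 2), (0, 0), (v.1 - 1, 1)}
  else if v.2 = 2 then {(0, 0), (v.1 - 1, 1), (v.1, 1)}
  else (parent t v.2).image (place k v.1)

/-- The neighbours of `v` that precede `v`. -/
def back (k t : ℕ) (v : ℕ × ℕ) : Finset (ℕ × ℕ) :=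
  if v.2 = 0 then ∅
  else if v.2 = 1 then
    if v.1 % (k + 1) = k then {place k v.1 0, (0, 0)} else {place k v.1 0}
  else if v.2 = 2 then {place k v.1 0, place k v.1 1}
  else (parent t v.2).image (place k v.1)

section parent

variable {t i : ℕ}

lemma parent_of_le (h : i ≤ t + 1) : parent t i = {0, 1, i - 1} := if_pos h

/-- The triangles are used from the far end `s = t - 1` down to `s = 2`. The bound `3 * t - 4`
admits only one vertex with `s = 2`; it is the only late vertex adjacent to the non-core vertex `2`.
-/
lemma exists_parent_eq (h : t + 2 ≤ i) (ht : 3 ≤ t) (hi : i ≤ 3 * t - 4) :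
    ∃ σ s, parent t i = {σ, s, s + 1} ∧ σ < 2 ∧ 2 ≤ s ∧ s + 1 ≤ t ∧ (s = 2 → i = 3 * t - 4) ∧
      i = t + 2 + 2 * (t - 1 - s) + σ := by
  refine ⟨(i - (t + 2)) % 2, t - 1 - (i - (t + 2)) / 2, (if_neg (by omega)).trans ?_, Nat.mod_lt _ two_pos,
    by omega, by omega, by omega, by omega⟩
  congr
  omega

lemma parent_lt (h3 : 3 ≤ i) (ht : 3 ≤ t) (hi : i ≤ 3 * t - 4) {c : ℕ} (hc : c ∈ parent t i) :
    c < i := by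
  rcases le_or_gt i (t + 1) with h | h
  · rw [parent_of_le h] at hc
    simp only [Finset.mem_insert, Finset.mem_singleton] at hc
    omega
  · obtain ⟨σ, s, hp, h1, h2, h4, -⟩ := exists_parent_eq h ht hi
    rw [hp] at hc
    simp only [Finset.mem_insert, Finset.mem_singleton] at hc
    omega

lemma card_parent (h3 : 3 ≤ i) (ht : 3 ≤ t) (hi : i ≤ 3 * t - 4) : (parent t i).card = 3 := by
  rcases le_or_gt i (t + 1) with h | h
  · rw [parent_of_le h]
    exact Finset.card_eq_three.2 ⟨_, _, _, by omega, by omega, by omega, rfl⟩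
  · obtain ⟨σ, s, hp, h1, h2, h4, -⟩ := exists_parent_eq h ht hi
    rw [hp]
    exact Finset.card_eq_three.2 ⟨_, _, _, by omega, by omega, by omega, rfl⟩

lemma exists_two_le_mem_parent (h3 : 3 ≤ i) (ht : 3 ≤ t) (hi : i ≤ 3 * t - 4) :
    ∃ c ∈ parent t i, 2 ≤ c := by
  rcases le_or_gt i (t + 1) with h | h
  · exact ⟨i - 1, by rw [parent_of_le h]; simp, by omega⟩
  · obtain ⟨σ, s, hp, h1, h2, h4, -⟩ := exists_parent_eq h ht hi
    exact ⟨s, by rw [hp]; simp, h2⟩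

lemma parent_injOn (ht : 3 ≤ t) : Set.InjOn (parent t) (Set.Icc 3 (3 * t - 4)) := by
  rintro i ⟨hi, hi'⟩ j ⟨hj, hj'⟩ h
  rcases le_or_gt i (t + 1) with h1 | h1 <;> rcases le_or_gt j (t + 1) with h2 | h2
  · have : i - 1 ∈ parent t j := by rw [← h, parent_of_le h1]; simp
    rw [parent_of_le h2] at this
    simp only [Finset.mem_insert, Finset.mem_singleton] at this
    omega
  · obtain ⟨σ, s, hp, g1, g2, g4, -⟩ := exists_parent_eq h2 ht hj'
    rw [hp, parent_of_le h1] at h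
    have e0 : 0 ∈ ({σ, s, s + 1} : Finset ℕ) := by simp [← h]
    have e1 : 1 ∈ ({σ, s, s + 1} : Finset ℕ) := by simp [← h]
    simp only [Finset.mem_insert, Finset.mem_singleton] at e0 e1
    omega
  · obtain ⟨σ, s, hp, g1, g2, g4, -⟩ := exists_parent_eq h1 ht hi'
    rw [hp, parent_of_le h2] at h
    have e0 : 0 ∈ ({σ, s, s + 1} : Finset ℕ) := by simp [h]
    have e1 : 1 ∈ ({σ, s, s + 1} : Finset ℕ) := by simp [h]
    simp only [Finset.mem_insert, Finset.mem_singleton] at e0 e1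
    omega
  · obtain ⟨σ, s, hp, g1, g2, g4, -, g5⟩ := exists_parent_eq h1 ht hi'
    obtain ⟨σ', s', hp', g1', g2', g4', -, g5'⟩ := exists_parent_eq h2 ht hj'
    rw [hp, hp'] at h
    have e0 : σ ∈ ({σ', s', s' + 1} : Finset ℕ) := by rw [← h]; simp
    have e1 : s + 1 ∈ ({σ', s', s' + 1} : Finset ℕ) := by rw [← h]; simp
    have e2 : s' + 1 ∈ ({σ, s, s + 1} : Finset ℕ) := by rw [h]; simp
    simp only [Finset.mem_insert, Finset.mem_singleton] at e0 e1 e2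
    omega

lemma exists_parent_eq_insert (h4 : 4 ≤ i) (ht : 3 ≤ t) (hi : i ≤ 3 * t - 4) :
    ∃ c, 3 ≤ c ∧ c < i ∧ ∃ a ∈ parent t c, parent t i = insert c ((parent t c).erase a) := by
  rcases le_or_gt i (t + 1) with h | h
  · refine ⟨i - 1, by omega, by omega, i - 2, ?_, ?_⟩
    · rw [parent_of_le (by omega)]
      simp only [Finset.mem_insert, Finset.mem_singleton]
      omega
    · rw [parent_of_le h, parent_of_le (by omega)]
      ext x
      simp only [Finset.mem_insert, Finset.mem_singleton, Finset.mem_erase]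
      omega
  · obtain ⟨σ, s, hp, h1, h2, h4, -⟩ := exists_parent_eq h ht (by omega)
    refine ⟨s + 1, by omega, by omega, 1 - σ, ?_, ?_⟩
    · rw [parent_of_le (by omega)]
      simp only [Finset.mem_insert, Finset.mem_singleton]
      omega
    · rw [hp, parent_of_le (by omega)]
      ext x
      simp only [Finset.mem_insert, Finset.mem_singleton, Finset.mem_erase]
      omega

end parent

section place

variable {k J : ℕ}

@[simp] lemma place_of_two_le {i : ℕ} (h : 2 ≤ i) : place k J i = (J, i) := by
  obtain ⟨i, rfl⟩ := Nat.exists_eq_add_of_le' h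
  rfl

lemma place_zero : place k J 0 = if J % (k + 1) = 1 then (0, 0) else (J - 1, 1) := rfl

lemma place_one : place k J 1 = if J % (k + 1) = 0 then (0, 0) else (J, 1) := rfl

lemma place_injective (hJ : 1 ≤ J) : Function.Injective (place k J) := by
  intro i j h
  match i, j with
  | 0, 0 => rfl
  | 1, 1 => rfl
  | 0, 1 =>
    rw [place_zero, place_one] at h
    split_ifs at h <;> simp at h <;> omega
  | 1, 0 =>
    rw [place_zero, place_one] at h
    split_ifs at h <;> simp at h <;> omega
  | 0, j + 2 =>
    rw [place_zero, place_of_two_le (by omega)] at h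
    split_ifs at h <;> simp at h
  | i + 2, 0 =>
    rw [place_zero, place_of_two_le (by omega)] at h
    split_ifs at h <;> simp at h
  | 1, j + 2 =>
    rw [place_one, place_of_two_le (by omega)] at h
    split_ifs at h <;> simp at h
  | i + 2, 1 =>
    rw [place_one, place_of_two_le (by omega)] at h
    split_ifs at h <;> simp at h
  | i + 2, j + 2 =>
    rw [place_of_two_le (by omega), place_of_two_le (by omega)] at h
    simpa using h

lemma place_cases (i : ℕ) : (place k J i = (0, 0) ∧ i < 2) ∨ (place k J i = (J - 1, 1) ∧ i = 0) ∨
    (place k J i = (J, 1) ∧ i = 1) ∨ (place k J i = (J, i) ∧ 2 ≤ i) := by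
  match i with
  | 0 =>
    rw [place_zero]
    split_ifs <;> simp
  | 1 =>
    rw [place_one]
    split_ifs <;> simp
  | i + 2 => simp

end place

/-! ### The rings inside one stacked triangulation -/

section tri

variable {k t : ℕ}

lemma tri_one (J : ℕ) : tri k t (J, 1) = {(0, 2), (0, 0), (J - 1, 1)} := rfl

lemma tri_two (J : ℕ) : tri k t (J, 2) = {(0, 0), (J - 1, 1), (J, 1)} := rfl

lemma tri_of_three_le {J i : ℕ} (h : 3 ≤ i) :
    tri k t (J, i) = (parent t i).image (place k J) := by
  rw [tri, if_neg (by simp only; omega), if_neg (by simp only; omega)]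

lemma lt_of_mem_tri (ht : 3 ≤ t) {J i : ℕ} (hJ : 1 ≤ J) (hi : 1 ≤ i) (him : i ≤ 3 * t - 4)
    {a : ℕ × ℕ} (ha : a ∈ tri k t (J, i)) : toLex a < toLex (J, i) := by
  rw [Prod.Lex.toLex_lt_toLex]
  obtain rfl | rfl | h3 : i = 1 ∨ i = 2 ∨ 3 ≤ i := by omega
  · rw [tri_one] at ha
    simp only [Finset.mem_insert, Finset.mem_singleton] at ha
    rcases ha with rfl | rfl | rfl <;> simp <;> omega
  · rw [tri_two] at ha
    simp only [Finset.mem_insert, Finset.mem_singleton] at ha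
    rcases ha with rfl | rfl | rfl <;> simp <;> omega
  · rw [tri_of_three_le h3, Finset.mem_image] at ha
    obtain ⟨c, hc, rfl⟩ := ha
    have := parent_lt h3 ht him hc
    rcases place_cases (k := k) (J := J) c with h | h | h | h <;> rw [h.1] <;> simp <;> omega

lemma card_tri (ht : 3 ≤ t) {J i : ℕ} (hJ : 1 ≤ J) (hi : 1 ≤ i)
    (him : i ≤ 3 * t - 4) : (tri k t (J, i)).card = 3 := by
  obtain rfl | rfl | h3 : i = 1 ∨ i = 2 ∨ 3 ≤ i := by omega
  · rw [tri_one]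
    exact Finset.card_eq_three.2 ⟨_, _, _, by simp, by simp, by simp, rfl⟩
  · rw [tri_two]
    exact Finset.card_eq_three.2 ⟨_, _, _, by simp, by simp, by simp; omega, rfl⟩
  · rw [tri_of_three_le h3, Finset.card_image_of_injective _ (place_injective hJ),
      card_parent h3 ht him]

lemma mem_tri_cases (ht : 3 ≤ t) {J i : ℕ} (hi : 1 ≤ i) (him : i ≤ 3 * t - 4)
    {a : ℕ × ℕ} (ha : a ∈ tri k t (J, i)) :
    (a.1 = 0 ∧ a.2 = 0) ∨ (a.1 = 0 ∧ a.2 = 2 ∧ i = 1) ∨ (a.1 = J - 1 ∧ a.2 = 1) ∨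
      (a.1 = J ∧ a.2 = 1 ∧ 2 ≤ i) ∨ (a.1 = J ∧ 2 ≤ a.2 ∧ a.2 < i) := by
  obtain rfl | rfl | h3 : i = 1 ∨ i = 2 ∨ 3 ≤ i := by omega
  · rw [tri_one] at ha
    simp only [Finset.mem_insert, Finset.mem_singleton] at ha
    rcases ha with rfl | rfl | rfl <;> simp
  · rw [tri_two] at ha
    simp only [Finset.mem_insert, Finset.mem_singleton] at ha
    rcases ha with rfl | rfl | rfl <;> simp
  · rw [tri_of_three_le h3, Finset.mem_image] at ha
    obtain ⟨c, hc, rfl⟩ := ha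
    have := parent_lt h3 ht him hc
    rcases place_cases (k := k) (J := J) c with h | h | h | h <;> rw [h.1] <;> simp <;> omega

/-- No triangle receives two vertices, as `exists_stackDrawing` requires. -/
lemma tri_inj (ht : 3 ≤ t) {J i J' i' : ℕ} (hJ : 1 ≤ J) (hi : 1 ≤ i)
    (him : i ≤ 3 * t - 4) (hJ' : 1 ≤ J') (hi' : 1 ≤ i') (him' : i' ≤ 3 * t - 4)
    (h : tri k t (J, i) = tri k t (J', i')) : (J, i) = (J', i') := by
  wlog hle : i ≤ i' generalizing J i J' i'
  · exact (this hJ' hi' him' hJ hi him h.symm (by omega)).symm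
  obtain rfl | rfl | h3 : i = 1 ∨ i = 2 ∨ 3 ≤ i := by omega
  · have h1 : (0, 2) ∈ tri k t (J', i') := by rw [← h, tri_one]; simp
    have h2 : (J - 1, 1) ∈ tri k t (J', i') := by rw [← h, tri_one]; simp
    have h3 := mem_tri_cases ht hi' him' h1
    have h4 := mem_tri_cases ht hi' him' h2
    rw [Prod.mk.injEq]
    dsimp only at h3 h4
    omega
  · have h1 : (J, 1) ∈ tri k t (J', i') := by rw [← h, tri_two]; simp
    obtain rfl | h3 : i' = 2 ∨ 3 ≤ i' := by omega
    · have h2 : (J', 1) ∈ tri k t (J, 2) := by rw [h, tri_two]; simp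
      have h3 := mem_tri_cases ht hi' him' h1
      have h4 := mem_tri_cases ht hi him h2
      rw [Prod.mk.injEq]
      dsimp only at h3 h4
      omega
    · obtain ⟨c, hc, hc2⟩ := exists_two_le_mem_parent h3 ht him'
      have h2 : (J', c) ∈ tri k t (J, 2) := by
        rw [h, tri_of_three_le h3]
        exact Finset.mem_image.2 ⟨c, hc, place_of_two_le hc2⟩
      have h4 := mem_tri_cases ht hi him h2
      dsimp only at h4
      omega
  · obtain ⟨c, hc, hc2⟩ := exists_two_le_mem_parent h3 ht him
    have h2 : (J, c) ∈ tri k t (J', i') := by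
      rw [← h, tri_of_three_le h3]
      exact Finset.mem_image.2 ⟨c, hc, place_of_two_le hc2⟩
    have h4 := mem_tri_cases ht hi' him' h2
    have hJJ : J = J' := by
      dsimp only at h4
      omega
    subst hJJ
    rw [tri_of_three_le h3, tri_of_three_le (h3.trans hle)] at h
    rw [parent_injOn ht ⟨h3, him⟩ ⟨h3.trans hle, him'⟩
      (Finset.image_injective (place_injective hJ) h)]

/-- The triangle that encloses the drawing. -/
def outer : Finset (ℕ × ℕ) := {(0, 2), (0, 0), (0, 1)}

lemma tri_subset (ht : 3 ≤ t) {N m : ℕ} (hm : m ≤ 3 * t - 4) {v : ℕ × ℕ}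
    (hv : v ∈ Finset.Icc 1 N ×ˢ Finset.Icc 1 m) :
    tri k t v ⊆ outer ∪ Finset.Icc 1 N ×ˢ Finset.Icc 1 m := by
  obtain ⟨J, i⟩ := v
  simp only [Finset.mem_product, Finset.mem_Icc] at hv
  intro a ha
  have := mem_tri_cases ht hv.2.1 (by omega) ha
  obtain ⟨b, c⟩ := a
  simp only [outer, Finset.mem_union, Finset.mem_insert, Finset.mem_singleton, Finset.mem_product,
    Finset.mem_Icc, Prod.mk.injEq] at this ⊢
  omega

lemma isFace_tri (ht : 3 ≤ t) {N m : ℕ} (hm : m ≤ 3 * t - 4) {v : ℕ × ℕ}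
    (hv : v ∈ Finset.Icc 1 N ×ˢ Finset.Icc 1 m) :
    IsFace outer (tri k t) (Finset.Icc 1 N ×ˢ Finset.Icc 1 m) (tri k t v) := by
  obtain ⟨J, i⟩ := v
  simp only [Finset.mem_product, Finset.mem_Icc] at hv
  obtain rfl | rfl | rfl | h4 : i = 1 ∨ i = 2 ∨ i = 3 ∨ 4 ≤ i := by omega
  · obtain rfl | hJ : J = 1 ∨ 2 ≤ J := by omega
    · exact Or.inl rfl
    · refine Or.inr ⟨(J - 1, 1), by simp; omega, (J - 2, 1), ?_, ?_⟩
      · rw [tri_one]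
        simp; omega
      · rw [tri_one, tri_one]
        ext ⟨b, c⟩
        simp only [Finset.mem_insert, Finset.mem_singleton, Finset.mem_erase, Prod.mk.injEq, ne_eq]
        omega
  · refine Or.inr ⟨(J, 1), by simp; omega, (0, 2), ?_, ?_⟩
    · rw [tri_one]
      simp
    · rw [tri_one, tri_two]
      ext ⟨b, c⟩
      simp only [Finset.mem_insert, Finset.mem_singleton, Finset.mem_erase, Prod.mk.injEq, ne_eq]
      omega
  -- Inserting `(J, 2)` creates three faces; the one used omits the corner that is not in block `J`.
  -- This is the hub, except in the first and the last block of a ring, where the hub replaces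
  -- vertex `0` or `1`.
  · refine Or.inr ⟨(J, 2), by simp; omega, if J % (k + 1) = 1 then (J - 1, 1) else
      if J % (k + 1) = 0 then (J, 1) else (0, 0), ?_, ?_⟩
    · rw [tri_two]
      split_ifs <;> simp
    · rw [tri_two, tri_of_three_le le_rfl, parent_of_le (by omega), Finset.image_insert,
        Finset.image_insert, Finset.image_singleton, place_zero, place_one,
        place_of_two_le (by omega)]
      ext ⟨b, c⟩
      split_ifs <;>
      simp only [Finset.mem_insert, Finset.mem_singleton, Finset.mem_erase, Prod.mk.injEq, ne_eq] <;>
      omega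
  · obtain ⟨c, hc3, hci, a, ha, h⟩ := exists_parent_eq_insert h4 ht (hv.2.2.trans hm)
    refine Or.inr ⟨(J, c), by simp; omega, place k J a, ?_, ?_⟩
    · rw [tri_of_three_le hc3]
      exact Finset.mem_image_of_mem _ ha
    · rw [tri_of_three_le hc3, tri_of_three_le (by omega), h, Finset.image_insert,
        Finset.image_erase (place_injective hv.1.1), place_of_two_le (by omega)]

lemma exists_stackDrawing_tri (ht : 3 ≤ t) {m : ℕ} (hm : m ≤ 3 * t - 4) (N : ℕ) :
    ∃ p, StackDrawing outer (tri k t) (Finset.Icc 1 N ×ˢ Finset.Icc 1 m) p := by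
  have h : ∀ {J i}, (J, i) ∈ Finset.Icc 1 N ×ˢ Finset.Icc 1 m →
      1 ≤ J ∧ 1 ≤ i ∧ i ≤ 3 * t - 4 := by
    intro J i hv
    simp only [Finset.mem_product, Finset.mem_Icc] at hv
    omega
  refine exists_stackDrawing toLex (by decide) _ ?_ ?_ (fun v hv => tri_subset ht hm hv) ?_
    (fun v hv => isFace_tri ht hm hv) ?_
  · rintro ⟨J, i⟩ hv
    have := h hv
    simp only [outer, Finset.mem_insert, Finset.mem_singleton, Prod.mk.injEq]
    omega
  · rintro ⟨J, i⟩ hv a ha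
    exact lt_of_mem_tri ht (h hv).1 (h hv).2.1 (h hv).2.2 ha
  · rintro ⟨J, i⟩ hv
    exact card_tri ht (h hv).1 (h hv).2.1 (h hv).2.2
  · rintro ⟨J, i⟩ hv ⟨J', i'⟩ hv' heq
    exact tri_inj ht (h hv).1 (h hv).2.1 (h hv).2.2 (h hv').1 (h hv').2.1 (h hv').2.2 heq

/-- Hence the graph is part of the stacked triangulation. The vertices `(J, 1)` and `(J, 2)` lose
those edges that would join a block to the hub or to the outer triangle; only the edge closing a
ring at the hub is kept. -/
lemma back_subset_tri (v : ℕ × ℕ) : back k t v ⊆ tri k t v := by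
  obtain ⟨J, i⟩ := v
  unfold back tri
  simp only
  split_ifs with h0 h1 h2 h3 h4
  · omega
  · exact Finset.empty_subset _
  · exact Finset.empty_subset _
  · rw [place_zero]
    split_ifs <;> simp [Finset.insert_subset_iff]
  · rw [place_zero]
    split_ifs <;> simp
  · rw [place_zero, place_one]
    split_ifs <;> simp [Finset.insert_subset_iff]
  · exact subset_rfl

end tri

/-! ### Enumerating the vertices and counting the edges -/

section code

variable {k t m : ℕ}

lemma back_hub (k t : ℕ) : back k t (0, 0) = ∅ := rfl

lemma back_one (J : ℕ) : back k t (J, 1) =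
    if J % (k + 1) = k then {place k J 0, (0, 0)} else {place k J 0} := rfl

lemma back_two (J : ℕ) : back k t (J, 2) = {place k J 0, place k J 1} := rfl

lemma back_of_three_le {J i : ℕ} (h : 3 ≤ i) :
    back k t (J, i) = (parent t i).image (place k J) := by
  rw [back, if_neg (by simp only; omega), if_neg (by simp only; omega),
    if_neg (by simp only; omega)]

lemma card_back_one (hk : 2 ≤ k) {J : ℕ} :
    (back k t (J, 1)).card = if J % (k + 1) = k then 2 else 1 := by
  rw [back_one]
  split_ifs with h
  · rw [place_zero, if_neg (by omega)]
    exact Finset.card_pair (by simp)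
  · simp

lemma card_back_two {J : ℕ} (hJ : 1 ≤ J) : (back k t (J, 2)).card = 2 := by
  rw [back_two]
  exact Finset.card_pair fun h => by simpa using place_injective hJ h

lemma card_back_of_three_le (ht : 3 ≤ t) {J i : ℕ} (hJ : 1 ≤ J) (hi : 3 ≤ i)
    (him : i ≤ 3 * t - 4) : (back k t (J, i)).card = 3 := by
  rw [back_of_three_le hi, Finset.card_image_of_injective _ (place_injective hJ),
    card_parent hi ht him]

/-- The vertices in use: the hub and the vertices `1, …, m` of each block, except for the vertex
`1` of the last block of a ring, whose place is taken by the hub. -/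
def IsVertex (k m : ℕ) (v : ℕ × ℕ) : Prop :=
  v = (0, 0) ∨ (1 ≤ v.1 ∧ 1 ≤ v.2 ∧ v.2 ≤ m ∧ (v.1 % (k + 1) = 0 → 2 ≤ v.2))

/-- The successor of a vertex in the lexicographic order. -/
def nextVertex (k m : ℕ) (v : ℕ × ℕ) : ℕ × ℕ :=
  if v.1 = 0 then (1, 1)
  else if v.2 < m then (v.1, v.2 + 1)
  else if (v.1 + 1) % (k + 1) = 0 then (v.1 + 1, 2) else (v.1 + 1, 1)

/-- The enumeration of the vertices in lexicographic order. -/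
def code (k m : ℕ) : ℕ → ℕ × ℕ
  | 0 => (0, 0)
  | n + 1 => nextVertex k m (code k m n)

lemma code_one (k m : ℕ) : code k m 1 = (1, 1) := rfl

lemma code_strictMono (k m : ℕ) : StrictMono fun n => toLex (code k m n) := by
  refine strictMono_nat_of_lt_succ fun n => ?_
  rw [Prod.Lex.toLex_lt_toLex, code, nextVertex]
  split_ifs <;> simp
  omega

lemma code_injective (k m : ℕ) : Function.Injective (code k m) := fun _ _ h =>
  (code_strictMono k m).injective (congrArg toLex h)

/-- The excess of `3 n` over the number of edges, up to a part that is constant on each block, for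
the `n` vertices preceding the vertex `i` of the `a`-th block of a ring, increased by `1`. -/
def excess (k a i : ℕ) : ℕ :=
  if a + 1 < k then if i = 1 then 1 else if i = 2 then 3 else 4
  else if a + 1 = k then min i 3
  else if i = 2 then 0 else 1

/-- Here `g` rings and `a` blocks of the next ring precede the block of the current vertex. A block
costs 3 edges, but a ring of `k + 1` blocks costs only `3 * k`. In the vertex count, each finished
ring is one vertex short, and so is the current ring in its last block, where the name `1` is
skipped. -/
lemma code_succ (hk : 2 ≤ k) (ht : 3 ≤ t) (hm : 3 ≤ m) (hmt : m ≤ 3 * t - 4) (n : ℕ) :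
    ∃ g a i, code k m (n + 1) = (g * (k + 1) + a + 1, i) ∧ a ≤ k ∧ 1 ≤ i ∧ i ≤ m ∧
      (a = k → 2 ≤ i) ∧
      n + 1 + g + (if a = k then 1 else 0) = g * ((k + 1) * m) + a * m + i ∧
      ∑ j ∈ Finset.range (n + 1), (back k t (code k m j)).card
        + (2 + 3 * (g * k) + 3 * a + excess k a i) = 3 * (n + 1) := by
  induction n with
  | zero =>
    refine ⟨0, 0, 1, by simp [code_one], by omega, le_rfl, by omega, by omega, by simp; omega, ?_⟩
    simp [code, back_hub, excess]
  | succ n ih =>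
    obtain ⟨g, a, i, hc, ha, hi, him, hak, hn, hE⟩ := ih
    have hmod : (g * (k + 1) + a + 1) % (k + 1) = if a = k then 0 else a + 1 := by
      split_ifs with h
      · rw [h, add_assoc, ← Nat.succ_mul, Nat.mul_mod_left]
      · rw [add_assoc, Nat.mul_add_mod_self_right, Nat.mod_eq_of_lt (by omega)]
    rw [Finset.sum_range_succ, hc]
    have hJ : 1 ≤ g * (k + 1) + a + 1 := by omega
    have hcode : code k m (n + 1 + 1) = nextVertex k m (g * (k + 1) + a + 1, i) := by
      rw [← hc]; rfl
    have hback : (back k t (g * (k + 1) + a + 1, i)).card =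
        if i = 1 then if a + 1 = k then 2 else 1 else if i = 2 then 2 else 3 := by
      obtain rfl | rfl | h3 : i = 1 ∨ i = 2 ∨ 3 ≤ i := by omega
      · rw [card_back_one hk, hmod]
        have : a ≠ k := by omega
        simp [this]
      · rw [card_back_two hJ]
        simp
      · rw [card_back_of_three_le ht hJ h3 (by omega), if_neg (by omega), if_neg (by omega)]
    have hsucc : (g * (k + 1) + a + 1 + 1) % (k + 1) = 0 ↔ a + 1 = k := by
      rw [Nat.add_mod, hmod]
      split_ifs with h
      · rw [zero_add, Nat.mod_mod, Nat.mod_eq_of_lt (by omega)]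
        omega
      · rw [Nat.mod_eq_of_lt (a := 1) (by omega)]
        obtain h1 | h1 : a + 1 = k ∨ a + 1 < k := by omega
        · simp [h1]
        · rw [Nat.mod_eq_of_lt (by omega)]
          omega
    rw [hback, hcode, nextVertex, if_neg (by simp only; omega)]
    simp only [hsucc]
    unfold excess at hE
    by_cases h1 : i < m
    · refine ⟨g, a, i + 1, by rw [if_pos h1], ha, by omega, h1, by omega, by omega, ?_⟩
      unfold excess
      split_ifs at hE ⊢ <;> omega
    rw [if_neg h1]
    obtain rfl : i = m := by omega
    by_cases h2 : a + 1 = k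
    · refine ⟨g, a + 1, 2, by rw [if_pos h2]; rfl, by omega, by omega, by omega, by omega, ?_, ?_⟩
      · rw [Nat.succ_mul a]
        split_ifs at hn ⊢ <;> omega
      · unfold excess
        split_ifs at hE ⊢ <;> omega
    rw [if_neg h2]
    by_cases h3 : a = k
    · refine ⟨g + 1, 0, 1, ?_, by omega, le_rfl, by omega, by omega, ?_, ?_⟩
      · rw [Nat.succ_mul, h3]
        rfl
      · rw [if_pos h3, h3] at hn
        have h4 : (k + 1) * i = k * i + i := Nat.succ_mul k i
        rw [if_neg (by omega), Nat.succ_mul g ((k + 1) * i)]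
        omega
      · unfold excess
        rw [Nat.succ_mul g k]
        split_ifs at hE ⊢ <;> omega
    · refine ⟨g, a + 1, 1, rfl, by omega, le_rfl, by omega, by omega, ?_, ?_⟩
      · rw [Nat.succ_mul a]
        split_ifs at hn ⊢
        omega
      · unfold excess
        split_ifs at hE ⊢ <;> omega

lemma isVertex_code (hk : 2 ≤ k) (ht : 3 ≤ t) (hm : 3 ≤ m) (hmt : m ≤ 3 * t - 4) (n : ℕ) :
    IsVertex k m (code k m n) := by
  cases n with
  | zero => exact Or.inl rfl
  | succ n =>
    obtain ⟨g, a, i, hc, ha, hi, him, hak, -⟩ := code_succ hk ht hm hmt n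
    rw [hc]
    refine Or.inr ⟨by simp only; omega, hi, him, fun h => hak ?_⟩
    by_contra h3
    rw [add_assoc, Nat.mul_add_mod_self_right, Nat.mod_eq_of_lt (by omega)] at h
    omega

lemma exists_code_eq (hk : 2 ≤ k) (hm : 3 ≤ m) {v : ℕ × ℕ} (hv : IsVertex k m v) :
    ∃ n, code k m n = v := by
  obtain ⟨J, i⟩ := v
  rcases hv with hv | ⟨hJ, hi, him, hJi⟩
  · exact ⟨0, hv.symm⟩
  simp only at hJ hi him hJi
  have step : ∀ J i i', 1 ≤ J → (∃ n, code k m n = (J, i)) → i ≤ i' → i' ≤ m →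
      ∃ n, code k m n = (J, i') := by
    intro J i i' hJ h hii'
    induction i', hii' using Nat.le_induction with
    | base => exact fun _ => h
    | succ i' _ ih =>
      intro him
      obtain ⟨n, hn⟩ := ih (by omega)
      refine ⟨n + 1, ?_⟩
      rw [code, hn, nextVertex, if_neg (by simp only; omega), if_pos (by simp only; omega)]
  have first : ∀ J, 1 ≤ J → ∃ n, code k m n = (J, if J % (k + 1) = 0 then 2 else 1) := by
    intro J hJ
    induction J, hJ using Nat.le_induction with
    | base => exact ⟨1, by rw [code_one, Nat.mod_eq_of_lt (by omega), if_neg one_ne_zero]⟩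
    | succ J hJ ih =>
      obtain ⟨n, hn⟩ := step J _ m hJ ih (by split_ifs <;> omega) le_rfl
      refine ⟨n + 1, ?_⟩
      rw [code, hn, nextVertex, if_neg (by simp only; omega), if_neg (by simp only; omega)]
      split_ifs <;> rfl
  exact step J _ i hJ (first J hJ) (by split_ifs <;> omega) him

lemma isVertex_place (hk : 2 ≤ k) {J i : ℕ} (hJ : 1 ≤ J) (hm : 3 ≤ m) (him : i ≤ m) :
    IsVertex k m (place k J i) := by
  match i with
  | 0 =>
    rw [place_zero]
    split_ifs with h
    · exact Or.inl rfl
    · obtain rfl | h2 : J = 1 ∨ 2 ≤ J := by omega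
      · exact absurd (Nat.mod_eq_of_lt (by omega)) h
      · refine Or.inr ⟨by simp only; omega, le_rfl, by simp only; omega, fun h3 => ?_⟩
        simp only at h3
        refine absurd ?_ h
        rw [show J = J - 1 + 1 by omega, Nat.add_mod, h3, zero_add, Nat.mod_mod,
          Nat.mod_eq_of_lt (by omega)]
  | 1 =>
    rw [place_one]
    split_ifs with h
    · exact Or.inl rfl
    · exact Or.inr ⟨hJ, le_rfl, by simp only; omega, fun h3 => absurd h3 h⟩
  | i + 2 => exact Or.inr ⟨hJ, by simp, him, fun _ => by simp⟩

lemma isVertex_of_mem_back (hk : 2 ≤ k) (ht : 3 ≤ t) (hm : 3 ≤ m) (hmt : m ≤ 3 * t - 4)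
    {v a : ℕ × ℕ} (hv : IsVertex k m v) (ha : a ∈ back k t v) : IsVertex k m a := by
  obtain ⟨J, i⟩ := v
  rcases hv with hv | ⟨hJ, hi, him, -⟩
  · rw [hv, back_hub] at ha
    exact absurd ha (Finset.notMem_empty _)
  simp only at hJ hi him
  obtain rfl | rfl | h3 : i = 1 ∨ i = 2 ∨ 3 ≤ i := by omega
  · rw [back_one] at ha
    have : a = place k J 0 ∨ a = (0, 0) := by
      split_ifs at ha <;> simp at ha <;> tauto
    rcases this with rfl | rfl
    · exact isVertex_place hk hJ hm (by omega)
    · exact Or.inl rfl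
  · rw [back_two, Finset.mem_insert, Finset.mem_singleton] at ha
    rcases ha with rfl | rfl <;> exact isVertex_place hk hJ hm (by omega)
  · rw [back_of_three_le h3, Finset.mem_image] at ha
    obtain ⟨c, hc, rfl⟩ := ha
    have := parent_lt h3 ht (by omega) hc
    exact isVertex_place hk hJ hm (by omega)

lemma lt_of_mem_back (ht : 3 ≤ t) (hmt : m ≤ 3 * t - 4) {v a : ℕ × ℕ} (hv : IsVertex k m v)
    (ha : a ∈ back k t v) : toLex a < toLex v := by
  obtain ⟨J, i⟩ := v
  rcases hv with hv | ⟨hJ, hi, him, -⟩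
  · rw [hv, back_hub] at ha
    exact absurd ha (Finset.notMem_empty _)
  · exact lt_of_mem_tri ht hJ hi (by simp only at him; omega) (back_subset_tri _ ha)

end code

/-- The graph on the first `n` vertices of the enumeration `code`. -/
def blockGraph (k t m n : ℕ) : SimpleGraph (Fin n) :=
  (SimpleGraph.fromRel fun u v => u ∈ back k t v).comap fun i : Fin n => code k m i

lemma sum_card_le_card_edgeFinset {n : ℕ} (G : SimpleGraph (Fin n)) [Fintype G.edgeSet]
    (N : Fin n → Finset (Fin n)) (h : ∀ i, ∀ j ∈ N i, j < i ∧ G.Adj j i) :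
    ∑ i, (N i).card ≤ G.edgeFinset.card := by
  rw [← Finset.card_sigma]
  refine Finset.card_le_card_of_injOn (fun x => s(x.2, x.1)) ?_ ?_
  · rintro ⟨i, j⟩ hx
    simp only [Finset.coe_sigma, Finset.coe_univ, Set.mem_sigma_iff, Set.mem_univ, true_and,
      Finset.mem_coe] at hx
    rw [Finset.mem_coe, SimpleGraph.mem_edgeFinset]
    exact (h i j hx).2
  · rintro ⟨i, j⟩ hx ⟨i', j'⟩ hx' heq
    simp only [Finset.coe_sigma, Finset.coe_univ, Set.mem_sigma_iff, Set.mem_univ, true_and,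
      Finset.mem_coe] at hx hx'
    have h1 := (h i j hx).1
    have h2 := (h i' j' hx').1
    rcases Sym2.eq_iff.1 heq with ⟨h3, h4⟩ | ⟨h3, h4⟩
    · simp only at h3 h4
      rw [h3, h4]
    · simp only at h3 h4
      rw [h3, h4] at h1
      exact absurd h1 (lt_asymm h2)

section blockGraph

variable {k t m n : ℕ}

/-- The vertices are enumerated lexicographically, so the earlier neighbours of each of the first
`n` vertices are among these `n` as well and no edge is lost. -/
lemma sum_card_back_le (hk : 2 ≤ k) (ht : 3 ≤ t) (hm : 3 ≤ m) (hmt : m ≤ 3 * t - 4)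
    [Fintype (blockGraph k t m n).edgeSet] :
    ∑ j ∈ Finset.range n, (back k t (code k m j)).card ≤ (blockGraph k t m n).edgeFinset.card := by
  rw [← Fin.sum_univ_eq_sum_range fun j => (back k t (code k m j)).card]
  refine le_trans (Finset.sum_le_sum fun i _ => ?_) (sum_card_le_card_edgeFinset _
    (fun i => Finset.univ.filter fun j : Fin n => code k m j ∈ back k t (code k m i)) ?_)
  · rw [← Finset.card_map ⟨fun j : Fin n => code k m j, fun a b h => Fin.ext (code_injective k m h)⟩]
    refine Finset.card_le_card fun a ha => ?_
    have hv := isVertex_code hk ht hm hmt i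
    obtain ⟨j, rfl⟩ := exists_code_eq hk hm (isVertex_of_mem_back hk ht hm hmt hv ha)
    have hji : j < i := (code_strictMono k m).lt_iff_lt.1 (lt_of_mem_back ht hmt hv ha)
    simp only [Finset.mem_map, Finset.mem_filter, Finset.mem_univ, true_and]
    exact ⟨⟨j, hji.trans i.isLt⟩, ha, rfl⟩
  · intro i j hj
    rw [Finset.mem_filter] at hj
    have hv := isVertex_code hk ht hm hmt i
    have hji : (j : ℕ) < i := (code_strictMono k m).lt_iff_lt.1 (lt_of_mem_back ht hmt hv hj.2)
    exact ⟨hji, fun h => hji.ne (code_injective k m h), Or.inl hj.2⟩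

lemma isPlanar_blockGraph (hk : 2 ≤ k) (ht : 3 ≤ t) (hm : 3 ≤ m) (hmt : m ≤ 3 * t - 4) :
    (blockGraph k t m n).IsPlanar := by
  -- The drawing covers all blocks up to the last one in use; it may have more vertices and edges
  -- than the graph.
  set N := (Finset.range n).sup fun j => (code k m j).1 with hN
  obtain ⟨p, D⟩ := exists_stackDrawing_tri (k := k) ht hmt N
  have hle : ∀ i : Fin n, (code k m i).1 ≤ N := fun i =>
    Finset.le_sup (f := fun j => (code k m j).1) (Finset.mem_range.2 i.isLt)
  have hmem : ∀ i : Fin n, code k m i = (0, 0) ∨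
      code k m i ∈ Finset.Icc 1 N ×ˢ Finset.Icc 1 m := by
    intro i
    rcases isVertex_code hk ht hm hmt i with h | ⟨h1, h2, h3, -⟩
    · exact Or.inl h
    · right
      rw [Finset.mem_product, Finset.mem_Icc, Finset.mem_Icc]
      exact ⟨⟨h1, hle i⟩, h2, h3⟩
  have key : ∀ i j : Fin n, code k m i ∈ back k t (code k m j) →
      code k m j ∈ Finset.Icc 1 N ×ˢ Finset.Icc 1 m ∧ code k m i ∈ tri k t (code k m j) := by
    intro i j h
    refine ⟨(hmem j).resolve_left fun h0 => ?_, back_subset_tri _ h⟩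
    rw [h0, back_hub] at h
    exact Finset.notMem_empty _ h
  refine D.isPlanar (f := fun i : Fin n => code k m i)
    (fun a b h => Fin.ext (code_injective k m h)) (fun i => ?_) fun i j h => ?_
  · rcases hmem i with h | h
    · rw [h]
      exact Finset.mem_union_left _ (by simp [outer])
    · exact Finset.mem_union_right _ h
  · rcases h.2 with h | h
    · exact Or.inr (Or.inl (key i j h))
    · exact Or.inr (Or.inr (key j i h))

end blockGraph

/-! ### There is no cycle of length `k` -/

section cycle

variable {k t m : ℕ}

/-- The ring of a vertex other than the hub. -/
def ringOf (k : ℕ) (v : ℕ × ℕ) : ℕ := (v.1 - 1) / (k + 1)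

/-- The position of a vertex in its ring: a block has the position of its vertex `0`. -/
def posOf (k : ℕ) (v : ℕ × ℕ) : ℕ :=
  if v = (0, 0) then 0 else if v.2 = 1 then (v.1 - 1) % (k + 1) + 1 else (v.1 - 1) % (k + 1)

/-- The vertices that two blocks have in common. -/
def IsJoint (v : ℕ × ℕ) : Prop := v = (0, 0) ∨ v.2 = 1

/-- The core vertices, which cover almost all edges. -/
def IsCore (t : ℕ) (v : ℕ × ℕ) : Prop := v = (0, 0) ∨ v.2 = 1 ∨ (3 ≤ v.2 ∧ v.2 ≤ t)

lemma exists_block {J : ℕ} (k : ℕ) (hJ : 1 ≤ J) :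
    ∃ g a, J = g * (k + 1) + a + 1 ∧ a ≤ k := by
  refine ⟨(J - 1) / (k + 1), (J - 1) % (k + 1), ?_, ?_⟩
  · have := Nat.div_add_mod' (J - 1) (k + 1)
    omega
  · have := Nat.mod_lt (J - 1) (show 0 < k + 1 by omega)
    omega

lemma ringOf_block {g a i : ℕ} (ha : a ≤ k) : ringOf k (g * (k + 1) + a + 1, i) = g := by
  rw [ringOf, Nat.add_sub_cancel, mul_comm, Nat.mul_add_div (Nat.succ_pos k),
    Nat.div_eq_of_lt (by omega), add_zero]

lemma block_mod {g a : ℕ} (ha : a ≤ k) : (g * (k + 1) + a) % (k + 1) = a := by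
  rw [Nat.mul_add_mod_self_right, Nat.mod_eq_of_lt (by omega)]

lemma posOf_hub (k : ℕ) : posOf k (0, 0) = 0 := rfl

lemma posOf_joint {g a : ℕ} (ha : a ≤ k) : posOf k (g * (k + 1) + a + 1, 1) = a + 1 := by
  rw [posOf, if_neg (by simp), if_pos rfl, Nat.add_sub_cancel, block_mod ha]

lemma posOf_inner {g a i : ℕ} (ha : a ≤ k) (hi : 2 ≤ i) :
    posOf k (g * (k + 1) + a + 1, i) = a := by
  rw [posOf, if_neg (by simp), if_neg (by simp only; omega), Nat.add_sub_cancel, block_mod ha]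

lemma succ_block_mod {g a : ℕ} (ha : a ≤ k) :
    (g * (k + 1) + a + 1) % (k + 1) = if a = k then 0 else a + 1 := by
  split_ifs with h
  · rw [h, add_assoc, ← Nat.succ_mul, Nat.mul_mod_left]
  · rw [add_assoc, Nat.mul_add_mod_self_right, Nat.mod_eq_of_lt (by omega)]

lemma place_block_zero (hk : 1 ≤ k) {g a : ℕ} (ha : a ≤ k) :
    place k (g * (k + 1) + a + 1) 0 = if a = 0 then (0, 0) else (g * (k + 1) + a, 1) := by
  rw [place_zero, succ_block_mod ha]
  rcases Nat.eq_zero_or_pos a with rfl | h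
  · rw [if_pos (by rw [if_neg (by omega)]), if_pos rfl]
  · rw [if_neg (fun h2 => by split_ifs at h2; omega), if_neg h.ne', Nat.add_sub_cancel]

lemma place_block_one {g a : ℕ} (ha : a ≤ k) :
    place k (g * (k + 1) + a + 1) 1 = if a = k then (0, 0) else (g * (k + 1) + a + 1, 1) := by
  rw [place_one, succ_block_mod ha]
  by_cases h : a = k
  · simp [h]
  · simp [h]

/-- The walk from `u` to `v` does not move or moves to the next common vertex of two blocks. -/
def StepTo (k : ℕ) (u v : ℕ × ℕ) : Prop := posOf k v = nextPos k (posOf k u) ∧ IsJoint v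

lemma place_step (hk : 1 ≤ k) {g a c : ℕ} (ha : a ≤ k) :
    let v := place k (g * (k + 1) + a + 1) c
    (v = (0, 0) ∨ ringOf k v = g) ∧ ((c ≠ 1 ∧ posOf k v = a) ∨
      (c = 1 ∧ posOf k v = nextPos k a ∧ IsJoint v)) := by
  intro v
  obtain h | h | h : c = 0 ∨ c = 1 ∨ 2 ≤ c := by omega
  · have hv : v = if a = 0 then (0, 0) else (g * (k + 1) + a, 1) := by
      rw [← place_block_zero hk ha]; exact congrArg (place k _) h
    by_cases h0 : a = 0
    · rw [if_pos h0] at hv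
      rw [hv]
      exact ⟨Or.inl rfl, Or.inl ⟨by omega, by rw [posOf_hub, h0]⟩⟩
    · obtain ⟨b, rfl⟩ := Nat.exists_eq_succ_of_ne_zero h0
      rw [if_neg h0] at hv
      rw [hv, Nat.succ_eq_add_one, ← add_assoc]
      exact ⟨Or.inr (ringOf_block (by omega)), Or.inl ⟨by omega, posOf_joint (by omega)⟩⟩
  · have hv : v = if a = k then (0, 0) else (g * (k + 1) + a + 1, 1) := by
      rw [← place_block_one ha]; exact congrArg (place k _) h
    by_cases h0 : a = k
    · rw [if_pos h0] at hv
      rw [hv]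
      exact ⟨Or.inl rfl, Or.inr ⟨h, by rw [posOf_hub, h0, nextPos, if_pos rfl], Or.inl rfl⟩⟩
    · rw [if_neg h0] at hv
      rw [hv]
      exact ⟨Or.inr (ringOf_block ha), Or.inr ⟨h, by rw [posOf_joint ha, nextPos, if_neg h0],
        Or.inr rfl⟩⟩
  · have hv : v = (g * (k + 1) + a + 1, c) := place_of_two_le h
    rw [hv]
    exact ⟨Or.inr (ringOf_block ha), Or.inl ⟨by omega, posOf_inner ha h⟩⟩

/-- Rings meet only in the hub, and within a ring one gets to another position only through a joint.
These are the hypotheses on the walk in `exists_position`. -/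
lemma step_of_mem_back (hk : 2 ≤ k) {u v : ℕ × ℕ} (hv : IsVertex k m v) (h : u ∈ back k t v) :
    (u = (0, 0) ∨ ringOf k u = ringOf k v) ∧
      (posOf k u = posOf k v ∨ StepTo k u v ∨ StepTo k v u) := by
  obtain ⟨J, i⟩ := v
  rcases hv with hv | ⟨hJ, hi, him, hJi⟩
  · rw [hv, back_hub] at h
    exact absurd h (Finset.notMem_empty _)
  simp only at hJ hi him hJi
  obtain ⟨g, a, rfl, ha⟩ := exists_block k hJ
  rw [succ_block_mod ha] at hJi
  rw [ringOf_block ha]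
  obtain rfl | h2 : i = 1 ∨ 2 ≤ i := by omega
  · have hak : a ≠ k := fun h0 => by simp [h0] at hJi
    rw [back_one, succ_block_mod ha] at h
    have h' : u = place k (g * (k + 1) + a + 1) 0 ∨ (u = (0, 0) ∧ a + 1 = k) := by
      by_cases h0 : a + 1 = k
      · simpa [hak, h0] using h
      · simpa [hak, h0] using h
    rcases h' with rfl | ⟨rfl, h0⟩
    · have := place_step (by omega) (c := 0) (g := g) ha
      simp only [ne_eq, zero_ne_one, not_false_eq_true, true_and, false_and, or_false] at this
      refine ⟨this.1, Or.inr (Or.inl ⟨?_, Or.inr rfl⟩)⟩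
      rw [this.2, posOf_joint ha, nextPos, if_neg hak]
    · refine ⟨Or.inl rfl, Or.inr (Or.inr ⟨?_, Or.inl rfl⟩)⟩
      rw [posOf_hub, posOf_joint ha, nextPos, if_pos h0]
  · have h' : ∃ c, u = place k (g * (k + 1) + a + 1) c := by
      obtain rfl | h3 : i = 2 ∨ 3 ≤ i := by omega
      · rw [back_two, Finset.mem_insert, Finset.mem_singleton] at h
        rcases h with h | h <;> exact ⟨_, h⟩
      · rw [back_of_three_le h3, Finset.mem_image] at h
        obtain ⟨c, -, h⟩ := h
        exact ⟨c, h.symm⟩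
    obtain ⟨c, rfl⟩ := h'
    obtain ⟨h1, h3⟩ := place_step (by omega) (c := c) (g := g) ha
    refine ⟨h1, ?_⟩
    unfold StepTo
    rw [posOf_inner ha h2]
    rcases h3 with ⟨-, h3⟩ | ⟨-, h3⟩
    · exact Or.inl h3
    · exact Or.inr (Or.inr h3)

lemma posOf_le {v : ℕ × ℕ} (hv : IsVertex k m v) : posOf k v ≤ k := by
  obtain ⟨J, i⟩ := v
  rcases hv with hv | ⟨hJ, hi, him, hJi⟩
  · rw [hv, posOf_hub]
    exact Nat.zero_le _
  simp only at hJ hi him hJi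
  obtain ⟨g, a, rfl, ha⟩ := exists_block k hJ
  rw [succ_block_mod ha] at hJi
  obtain rfl | h2 : i = 1 ∨ 2 ≤ i := by omega
  · have hak : a ≠ k := fun h0 => by simp [h0] at hJi
    rw [posOf_joint ha]
    omega
  · rw [posOf_inner ha h2]
    exact ha

lemma joint_unique {u v : ℕ × ℕ} {g : ℕ} (hu : IsVertex k m u) (hv : IsVertex k m v)
    (hju : IsJoint u) (hjv : IsJoint v) (hgu : u = (0, 0) ∨ ringOf k u = g)
    (hgv : v = (0, 0) ∨ ringOf k v = g) (h : posOf k u = posOf k v) : u = v := by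
  have key : ∀ {w : ℕ × ℕ}, IsVertex k m w → IsJoint w → (w = (0, 0) ∨ ringOf k w = g) →
      w = if posOf k w = 0 then (0, 0) else (g * (k + 1) + posOf k w, 1) := by
    intro w hw hj hg
    by_cases h0 : w = (0, 0)
    · rw [h0, posOf_hub, if_pos rfl]
    obtain ⟨J, i⟩ := w
    obtain rfl : i = 1 := hj.resolve_left h0
    obtain ⟨b, a, rfl, ha⟩ := exists_block k (hw.resolve_left h0).1
    have := hg.resolve_left h0
    rw [ringOf_block ha] at this
    rw [posOf_joint ha, if_neg (by omega), this, add_assoc]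
  rw [key hu hju hgu, key hv hjv hgv, h]

/-- The block at position `T` contains the joint at `T` as its vertex `0` and the next joint as its
vertex `1`, so the core vertices that a `k`-cycle can visit are among `t` places. -/
lemma mem_image_place {u : ℕ × ℕ} {g T : ℕ} (hk : 1 ≤ k) (hT : T ≤ k) (hu : IsVertex k m u)
    (hg : u = (0, 0) ∨ ringOf k u = g) (hcore : IsCore t u)
    (hpos : posOf k u = T ∨ (posOf k u = nextPos k T ∧ IsJoint u)) :
    u ∈ (({0, 1} : Finset ℕ) ∪ Finset.Icc 3 t).image (place k (g * (k + 1) + T + 1)) := by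
  rw [Finset.mem_image]
  by_cases h0 : u = (0, 0)
  · rw [h0, posOf_hub] at hpos
    unfold nextPos at hpos
    by_cases hT0 : T = 0
    · exact ⟨0, by simp, by rw [place_block_zero hk hT, if_pos hT0, h0]⟩
    · have hTk : T = k := by
        by_contra hTk
        rw [if_neg hTk] at hpos
        omega
      exact ⟨1, by simp, by rw [place_block_one hT, if_pos hTk, h0]⟩
  obtain ⟨J, i⟩ := u
  obtain ⟨hJ, hi, him, hJi⟩ := hu.resolve_left h0
  obtain ⟨b, a, rfl, ha⟩ := exists_block k hJ
  have hb := hg.resolve_left h0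
  rw [ringOf_block ha] at hb
  subst hb
  rcases hcore.resolve_left h0 with h1 | ⟨h1, h1'⟩
  · simp only at h1
    subst h1
    rw [posOf_joint ha] at hpos
    unfold nextPos at hpos
    rcases hpos with h2 | ⟨h2, -⟩
    · refine ⟨0, by simp, ?_⟩
      rw [place_block_zero hk hT, if_neg (by omega), ← h2, add_assoc]
    · split_ifs at h2 with h3
      refine ⟨1, by simp, ?_⟩
      rw [place_block_one hT, if_neg h3, show a = T by omega]
  · simp only at h1 h1'
    have : ¬ IsJoint (b * (k + 1) + a + 1, i) := by
      rintro (h2 | h2)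
      · exact h0 h2
      · simp only at h2
        omega
    rw [posOf_inner ha (by omega)] at hpos
    have h2 : a = T := hpos.resolve_right fun h => this h.2
    refine ⟨i, ?_, ?_⟩
    · simp only [Finset.mem_union, Finset.mem_Icc]
      exact Or.inr ⟨h1, h1'⟩
    · rw [place_of_two_le (by omega), h2]

/-- Vertex `t + 1` sees only `0, 1, t` before it, and a vertex in `{σ, s, s + 1}` has core
neighbours unless `s = 2`, which forces the name `3 * t - 4`. So at most one edge per block escapes
the core. -/
lemma not_core_cases (ht : 3 ≤ t) (hmt : m ≤ 3 * t - 4) {u v : ℕ × ℕ} (hv : IsVertex k m v)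
    (h : u ∈ back k t v) (hu : ¬ IsCore t u) (hv' : ¬ IsCore t v) :
    m = 3 * t - 4 ∧ u = (v.1, 2) ∧ v.2 = m := by
  have hcore : ∀ {J c}, c = 0 ∨ c = 1 ∨ (3 ≤ c ∧ c ≤ t) → IsCore t (place k J c) := by
    intro J c hc
    unfold IsCore
    rcases place_cases (k := k) (J := J) c with h | h | h | h
    · exact Or.inl h.1
    · rw [h.1]; exact Or.inr (Or.inl rfl)
    · rw [h.1]; exact Or.inr (Or.inl rfl)
    · rw [h.1]
      exact Or.inr (Or.inr (by simp only; omega))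
  obtain ⟨J, i⟩ := v
  simp only [IsCore, not_or, not_and, not_le] at hv'
  obtain ⟨hJ, hi, him, -⟩ := hv.resolve_left hv'.1
  simp only at hJ hi him ⊢
  obtain rfl | h3 : i = 2 ∨ 3 ≤ i := by omega
  · rw [back_two, Finset.mem_insert, Finset.mem_singleton] at h
    rcases h with rfl | rfl
    · exact absurd (hcore (by omega)) hu
    · exact absurd (hcore (by omega)) hu
  · have hti := hv'.2.2 h3
    rw [back_of_three_le h3, Finset.mem_image] at h
    obtain ⟨c, hc, rfl⟩ := h
    have hc' : ¬ (c = 0 ∨ c = 1 ∨ (3 ≤ c ∧ c ≤ t)) := fun h => hu (hcore h)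
    rcases le_or_gt i (t + 1) with h1 | h1
    · rw [parent_of_le h1] at hc
      simp only [Finset.mem_insert, Finset.mem_singleton] at hc
      omega
    · obtain ⟨σ, s, hp, g1, g2, g4, g5, -⟩ := exists_parent_eq h1 ht (by omega)
      rw [hp] at hc
      simp only [Finset.mem_insert, Finset.mem_singleton] at hc
      obtain rfl : c = 2 := by omega
      have := g5 (by omega)
      exact ⟨by omega, by simp, by omega⟩

/-- The vertices of a cycle of length `k` lie in one block. -/
lemma exists_block_of_cycle [NeZero k] (hk : 3 ≤ k) {c : Fin k → ℕ × ℕ}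
    (hc : Function.Injective c) (hv : ∀ i, IsVertex k m (c i))
    (hadj : ∀ i, c i ∈ back k t (c (i + 1)) ∨ c (i + 1) ∈ back k t (c i)) :
    ∃ g, ∃ T ≤ k, ∀ i, (c i = (0, 0) ∨ ringOf k (c i) = g) ∧
      (posOf k (c i) = T ∨ (posOf k (c i) = nextPos k T ∧ IsJoint (c i))) := by
  obtain ⟨g, hg⟩ : ∃ g, ∀ i, c i = (0, 0) ∨ ringOf k (c i) = g := by
    have hring : ∀ i, c i ≠ (0, 0) → c (i + 1) ≠ (0, 0) →
        ringOf k (c i) = ringOf k (c (i + 1)) := by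
      intro i h1 h2
      rcases hadj i with h | h
      · exact (step_of_mem_back (by omega) (hv _) h).1.resolve_left h1
      · exact ((step_of_mem_back (by omega) (hv _) h).1.resolve_left h2).symm
    -- The cycle visits the hub at most once, and off the hub it cannot change rings.
    by_cases hhub : ∃ s, c s = (0, 0)
    · obtain ⟨s, hs⟩ := hhub
      have hne : ∀ i, i ≠ s → c i ≠ (0, 0) := fun i hi h => hi (hc (h.trans hs.symm))
      obtain ⟨j, hj⟩ : ∃ j, j ≠ s := by
        have : Nontrivial (Fin k) := Fin.nontrivial_iff_two_le.2 (by omega)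
        exact exists_ne s
      refine ⟨ringOf k (c j), fun i => ?_⟩
      by_cases hi : i = s
      · exact Or.inl (by rw [hi, hs])
      · refine Or.inr ((iff_of_forall_iff_add_one (P := fun i => ringOf k (c i) = ringOf k (c j)) s
          (fun i h1 h2 => ?_) hi hj).2 rfl)
        simp only [hring i (hne i h1) (hne _ h2)]
    · push Not at hhub
      refine ⟨ringOf k (c 0), fun i => Or.inr ((iff_of_forall_iff_add_one'
        (P := fun i => ringOf k (c i) = ringOf k (c 0)) (fun i => ?_) i 0).2 rfl)⟩
      simp only [hring i (hhub i) (hhub _)]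
  have hstep : ∀ i, posOf k (c (i + 1)) = posOf k (c i) ∨ StepTo k (c i) (c (i + 1)) ∨
      StepTo k (c (i + 1)) (c i) := by
    intro i
    rcases hadj i with h | h
    · rcases (step_of_mem_back (by omega) (hv _) h).2 with h | h | h
      · exact Or.inl h.symm
      · exact Or.inr (Or.inl h)
      · exact Or.inr (Or.inr h)
    · rcases (step_of_mem_back (by omega) (hv _) h).2 with h | h | h
      · exact Or.inl h
      · exact Or.inr (Or.inr h)
      · exact Or.inr (Or.inl h)
  obtain ⟨T, hT, h⟩ := exists_position (f := fun i => posOf k (c i))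
    (joint := fun i => IsJoint (c i)) (by omega) (fun i => posOf_le (hv i)) hstep
    (fun i j hi hj hij => hc (joint_unique (hv i) (hv j) hi hj (hg i) (hg j) hij))
  exact ⟨g, T, hT, fun i => ⟨hg i, h i⟩⟩

/-- There is no cycle of length `k`. -/
lemma not_exists_cycle [NeZero k] (ht : 3 ≤ t)
    (hm : (k = 2 * t + 1 ∧ m = 3 * t - 5) ∨ (k = 2 * t + 2 ∧ m = 3 * t - 4)) {c : Fin k → ℕ × ℕ}
    (hc : Function.Injective c) (hv : ∀ i, IsVertex k m (c i))
    (hadj : ∀ i, c i ∈ back k t (c (i + 1)) ∨ c (i + 1) ∈ back k t (c i)) : False := by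
  classical
  obtain ⟨g, T, hT, h⟩ := exists_block_of_cycle (by omega) hc hv hadj
  have hcore : (Finset.univ.filter fun i => IsCore t (c i)).card ≤ t := by
    calc _ ≤ ((({0, 1} : Finset ℕ) ∪ Finset.Icc 3 t).image
          (place k (g * (k + 1) + T + 1))).card := by
          refine Finset.card_le_card_of_injOn c (fun i hi => ?_) (hc.injOn)
          rw [Finset.mem_coe, Finset.mem_filter] at hi
          exact mem_image_place (by omega) hT (hv i) (h i).1 hi.2 (h i).2
      _ ≤ _ := Finset.card_image_le
      _ ≤ _ := Finset.card_union_le _ _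
      _ ≤ t := by
        rw [Finset.card_pair zero_ne_one, Nat.card_Icc]
        omega
  have hfst : ∀ i, ¬ IsCore t (c i) → (c i).1 = g * (k + 1) + T + 1 := by
    intro i hi
    have h1 := hv i
    obtain ⟨h2, h3⟩ := h i
    generalize c i = u at *
    simp only [IsCore, not_or, not_and, not_le] at hi
    obtain ⟨J, l⟩ := u
    obtain ⟨hJ, hl, -⟩ := h1.resolve_left hi.1
    obtain ⟨b, a, rfl, ha⟩ := exists_block k hJ
    have h2 := h2.resolve_left hi.1
    rw [ringOf_block ha] at h2
    have h4 := hi.2.1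
    simp only at hl h4 ⊢
    rw [posOf_inner ha (by omega)] at h3
    have h5 : a = T := h3.resolve_right fun h => by
      rcases h.2 with h | h
      · exact hi.1 h
      · exact h4 h
    rw [h2, h5]
  have hedge : ∀ i, ¬ IsCore t (c i) ∧ ¬ IsCore t (c (i + 1)) → m = 3 * t - 4 ∧
      ((c i = (g * (k + 1) + T + 1, 2) ∧ c (i + 1) = (g * (k + 1) + T + 1, m)) ∨
        (c i = (g * (k + 1) + T + 1, m) ∧ c (i + 1) = (g * (k + 1) + T + 1, 2))) := by
    rintro i ⟨h1, h2⟩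
    rcases hadj i with h3 | h3
    · obtain ⟨g1, g2, g3⟩ := not_core_cases ht (by omega) (hv _) h3 h1 h2
      rw [hfst _ h2] at g2
      exact ⟨g1, Or.inl ⟨g2, Prod.ext (hfst _ h2) g3⟩⟩
    · obtain ⟨g1, g2, g3⟩ := not_core_cases ht (by omega) (hv _) h3 h2 h1
      rw [hfst _ h1] at g2
      exact ⟨g1, Or.inr ⟨Prod.ext (hfst _ h1) g3, g2⟩⟩
  rcases hm with ⟨hkt, hm⟩ | ⟨hkt, hm⟩
  · have := le_two_mul_add_of_cover (c := 0) hcore (by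
      rw [Nat.le_zero, Finset.card_eq_zero, Finset.filter_eq_empty_iff]
      intro i _ hi
      have := (hedge i hi).1
      omega)
    omega
  · have := le_two_mul_add_of_cover (c := 1) hcore (by
      rw [Finset.card_le_one]
      intro i hi j hj
      rw [Finset.mem_filter] at hi hj
      -- The same edge cannot be traversed in both directions, since `j + 2 ≠ j` modulo `k`.
      have key : ∀ {i j}, c i = c (j + 1) → c (i + 1) = c j → i = j := by
        intro i j h1 h2
        have h3 := hc h1
        have h4 := hc h2
        rw [h3, add_assoc, add_eq_left] at h4
        have h5 := congrArg Fin.val h4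
        rw [Fin.val_add, Fin.val_zero, Fin.val_one', Nat.mod_eq_of_lt (a := 1) (by omega),
          Nat.mod_eq_of_lt (by omega)] at h5
        omega
      rcases (hedge i hi.2).2 with h1 | h1 <;> rcases (hedge j hj.2).2 with h2 | h2
      · exact hc (h1.1.trans h2.1.symm)
      · exact key (h1.1.trans h2.2.symm) (h1.2.trans h2.1.symm)
      · exact key (h1.1.trans h2.2.symm) (h1.2.trans h2.1.symm)
      · exact hc (h1.1.trans h2.1.symm))
    omega

end cycle

theorem cycleGraph_free_blockGraph {k t m : ℕ} (n : ℕ) (ht : 5 ≤ t)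
    (hm : (k = 2 * t + 1 ∧ m = 3 * t - 5) ∨ (k = 2 * t + 2 ∧ m = 3 * t - 4)) :
    (SimpleGraph.cycleGraph k).Free (blockGraph k t m n) := by
  rintro ⟨f⟩
  obtain ⟨l, rfl⟩ : ∃ l, k = l + 2 := ⟨k - 2, by omega⟩
  refine not_exists_cycle (by omega) hm (c := fun i => code (l + 2) m (f i))
    (fun i j h => f.injective (Fin.ext (code_injective _ _ h)))
    (fun i => isVertex_code (t := t) (by omega) (by omega) (by omega) (by omega) _) (fun i => ?_)
  have h : (SimpleGraph.cycleGraph (l + 2)).Adj i (i + 1) := by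
    rw [SimpleGraph.cycleGraph_adj]
    exact Or.inr (by simp)
  exact (f.toHom.map_adj h).2

/-! ### Bounds on the planar Turán number -/

lemma planarTuranNumber_le {n : ℕ} (hn : 3 ≤ n) {W : Type*} (H : SimpleGraph W) :
    SimpleGraph.planarTuranNumber n H ≤ 3 * n - 6 := by
  classical
  unfold SimpleGraph.planarTuranNumber
  refine Finset.sup_le fun G hG => ?_
  have := IsPlanar.card_edgeFinset_add_six_le (Finset.mem_filter.1 hG).2.1 (by simpa using hn)
  rw [Fintype.card_fin] at this
  omega

lemma card_edgeFinset_le_planarTuranNumber {n : ℕ} {W : Type*} {H : SimpleGraph W}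
    {G : SimpleGraph (Fin n)} [Fintype G.edgeSet] (hG : G.IsPlanar) (hH : H.Free G) :
    G.edgeFinset.card ≤ SimpleGraph.planarTuranNumber n H := by
  classical
  unfold SimpleGraph.planarTuranNumber
  refine le_trans (le_of_eq ?_) (Finset.le_sup (b := G)
    (Finset.mem_filter.2 ⟨Finset.mem_univ G, hG, hH⟩))
  congr!

section bounds

variable {k t m : ℕ}

lemma sum_card_back_le_planarTuranNumber (n : ℕ) (ht : 5 ≤ t)
    (hm : (k = 2 * t + 1 ∧ m = 3 * t - 5) ∨ (k = 2 * t + 2 ∧ m = 3 * t - 4)) :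
    ∑ j ∈ Finset.range n, (back k t (code k m j)).card ≤
      SimpleGraph.planarTuranNumber n (SimpleGraph.cycleGraph k) := by
  classical
  exact (sum_card_back_le (by omega) (by omega) (by omega) (by omega)).trans
    (card_edgeFinset_le_planarTuranNumber
      (isPlanar_blockGraph (by omega) (by omega) (by omega) (by omega))
      (cycleGraph_free_blockGraph n ht hm))

lemma planarTuranNumber_cycleGraph_eq {n : ℕ} (ht : 5 ≤ t)
    (hm : (k = 2 * t + 1 ∧ m = 3 * t - 5) ∨ (k = 2 * t + 2 ∧ m = 3 * t - 4)) (hn : 3 ≤ n)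
    (hnm : n ≤ m + 1) :
    SimpleGraph.planarTuranNumber n (SimpleGraph.cycleGraph k) = 3 * n - 6 := by
  refine le_antisymm (planarTuranNumber_le hn _) (le_trans ?_
    (sum_card_back_le_planarTuranNumber n ht hm))
  obtain ⟨n, rfl⟩ : ∃ l, n = l + 1 := ⟨n - 1, by omega⟩
  obtain ⟨g, a, i, -, ha, hi, him, hak, hcount, hE⟩ := code_succ (k := k) (t := t) (m := m)
    (by omega) (by omega) (by omega) (by omega) n
  have hg : g = 0 := by
    by_contra h0
    have h1 : 1 ≤ g := by omega
    have h2 : g * (12 * m) ≤ g * ((k + 1) * m) := by gcongr; omega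
    have h3 : g * 10 ≤ g * m := by gcongr; omega
    have h4 : 1 * m ≤ g * m := by gcongr
    have h5 : g * (12 * m) = 12 * (g * m) := by ring
    split_ifs at hcount <;> omega
  subst hg
  have ha1 : a ≤ 1 := by
    by_contra h0
    have h1 : 2 * m ≤ a * m := by gcongr; omega
    split_ifs at hcount <;> omega
  unfold excess at hE
  obtain rfl | rfl : a = 0 ∨ a = 1 := by omega
  · split_ifs at hcount hE <;> omega
  · split_ifs at hcount hE <;> omega

/-- This is bound (ii) cleared of denominators. The construction wins 3 edges per ring of `k + 1`
blocks, which is at least the required `2 / (k - 1)` per block; the rest is a comparison of the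
initial and final terms. -/
lemma two_mul_add_four_le {n q r : ℕ} (ht : 5 ≤ t)
    (hm : (k = 2 * t + 1 ∧ m = 3 * t - 5) ∨ (k = 2 * t + 2 ∧ m = 3 * t - 4))
    (hn : n = 4 + q * m + r) (hr : r < m) :
    (2 * q + 4 : ℤ) ≤ (k - 1) *
      (SimpleGraph.planarTuranNumber n (SimpleGraph.cycleGraph k) - 3 * n + 3 * q + 10 +
        min (r : ℤ) 1) := by
  have hP := sum_card_back_le_planarTuranNumber n ht hm
  obtain ⟨l, rfl⟩ : ∃ l, n = l + 1 := ⟨n - 1, by omega⟩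
  obtain ⟨g, a, i, -, ha, hi, him, hak, hcount, hE⟩ := code_succ (k := k) (t := t) (m := m)
    (by omega) (by omega) (by omega) (by omega) l
  generalize ∑ j ∈ Finset.range (l + 1), (back k t (code k m j)).card = s at hP hE
  generalize SimpleGraph.planarTuranNumber (l + 1) (SimpleGraph.cycleGraph k) = P at hP ⊢
  obtain ⟨K, rfl⟩ : ∃ K, k = K + 1 := ⟨k - 1, by omega⟩
  have hK : 10 ≤ K := by omega
  have hm10 : 10 ≤ m := by omega
  -- In the last block of a ring the name `1` is skipped, so the count there is one less than `i`.
  obtain ⟨x, hx1, hxm, hx⟩ : ∃ x, 1 ≤ x ∧ x ≤ m ∧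
      l + 1 + g = (g * (K + 1 + 1) + a) * m + x := by
    have : g * ((K + 1 + 1) * m) + a * m = (g * (K + 1 + 1) + a) * m := by ring
    split_ifs at hcount with h
    · exact ⟨i - 1, by omega, by omega, by omega⟩
    · exact ⟨i, by omega, by omega, by omega⟩
  -- Each finished ring saves a vertex, so the construction may be `d` blocks ahead of the quotient
  -- `q`.
  obtain ⟨d, hd⟩ : ∃ d, g * (K + 1 + 1) + a = q + d := by
    refine Nat.exists_eq_add_of_le ?_
    by_contra! h
    have : (g * (K + 1 + 1) + a + 1) * m ≤ q * m := by gcongr; omega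
    rw [Nat.succ_mul] at this
    omega
  have hdm : d * m + x = 4 + r + g := by
    rw [hd, Nat.add_mul] at hx
    omega
  have he : (a < K → excess (K + 1) a i ≤ 4) ∧ (a = K → excess (K + 1) a i ≤ 3) ∧
      (a = K + 1 → excess (K + 1) a i ≤ 1) := by
    unfold excess
    split_ifs <;> omega
  have hρ : d = 1 → g ≤ 1 → 1 ≤ r := by
    rintro rfl hg
    omega
  have hd2 : 2 ≤ d → 10 * d ≤ g + 12 := by
    intro h
    obtain ⟨b, rfl⟩ := Nat.exists_eq_add_of_le' h
    have h1 : (b + 2) * m = (b + 1) * m + m := by ring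
    have h2 : (b + 1) * 10 ≤ (b + 1) * m := by gcongr
    omega
  generalize excess (K + 1) a i = e at *
  -- This is `hmain'` below with `q = g * (K + 2) + a - d` inserted and `2 * g * K` cancelled. The
  -- factor of `K` is bounded below by an explicit `c`, and `10 ≤ K` does the rest.
  have hmain : (4 * g + 2 * a + 4 - 2 * d : ℤ) ≤ K * (8 + min (r : ℤ) 1 + g - 3 * d - e) := by
    have hKg : (10 * g : ℤ) ≤ K * g := by gcongr; exact_mod_cast hK
    have hr0 : (0 : ℤ) ≤ min (r : ℤ) 1 := by omega
    have hr1 : 1 ≤ r → min (r : ℤ) 1 = 1 := by omega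
    generalize min (r : ℤ) 1 = ρ at *
    have key : ∀ c : ℤ, c ≤ 8 + ρ + g - 3 * d - e →
        (4 * g + 2 * a + 4 - 2 * d : ℤ) ≤ K * c → (4 * g + 2 * a + 4 - 2 * d : ℤ) ≤
          K * (8 + ρ + g - 3 * d - e) := fun c hc h => h.trans (by gcongr)
    have haK : (a < K ∧ e ≤ 4) ∨ (a = K ∧ e ≤ 3) ∨ (a = K + 1 ∧ e ≤ 1) := by omega
    obtain rfl | rfl | h2 : d = 0 ∨ d = 1 ∨ 2 ≤ d := by omega
    · rcases haK with ⟨h3, h4⟩ | ⟨h3, h4⟩ | ⟨h3, h4⟩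
      · exact key (4 + g) (by push_cast; omega) (by rw [mul_add]; push_cast; omega)
      · exact key (5 + g) (by push_cast; omega) (by rw [mul_add]; push_cast; omega)
      · exact key (7 + g) (by push_cast; omega) (by rw [mul_add]; push_cast; omega)
    · rcases haK with ⟨h3, h4⟩ | ⟨h3, h4⟩ | ⟨h3, h4⟩
      · obtain hg | hg : g ≤ 1 ∨ 2 ≤ g := by omega
        · have := hρ rfl hg
          exact key (2 + g) (by push_cast; omega) (by rw [mul_add]; push_cast; omega)
        · have h5 : (0 : ℤ) ≤ g - 2 := by omega
          have h6 : (10 * (g - 2) : ℤ) ≤ K * (g - 2) := by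
            gcongr
            exact_mod_cast hK
          exact key (3 + (g - 2)) (by push_cast; omega) (by rw [mul_add]; push_cast; omega)
      · obtain hg | hg : g ≤ 1 ∨ 2 ≤ g := by omega
        · have := hρ rfl hg
          exact key (3 + g) (by push_cast; omega) (by rw [mul_add]; push_cast; omega)
        · exact key (2 + g) (by push_cast; omega) (by rw [mul_add]; push_cast; omega)
      · exact key (4 + g) (by push_cast; omega) (by rw [mul_add]; push_cast; omega)
    · have h3 := hd2 h2
      have h5 : (0 : ℤ) ≤ g + 2 - 3 * d := by omega
      have h6 : (10 * (g + 2 - 3 * d) : ℤ) ≤ K * (g + 2 - 3 * d) := by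
        gcongr
        exact_mod_cast hK
      refine key (2 + (g + 2 - 3 * d)) (by omega) ?_
      rw [mul_add]
      omega
  have hmain' : (2 * q + 4 : ℤ) ≤ K * (8 + min (r : ℤ) 1 + 3 * g - 3 * d - e) := by
    have : (q : ℤ) = g * (K + 1 + 1) + a - d := by
      have := congrArg (Nat.cast : ℕ → ℤ) hd
      push_cast at this
      linarith
    rw [this]
    linarith
  push_cast at hE ⊢
  have hE' : (s : ℤ) + (2 + 3 * (g * (K + 1)) + 3 * a + e) = 3 * (l + 1) := by exact_mod_cast hE
  have hd' : (g * (K + 1 + 1) + a : ℤ) = q + d := by exact_mod_cast hd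
  have hP' : (s : ℤ) ≤ P := by exact_mod_cast hP
  refine hmain'.trans ?_
  rw [add_sub_cancel_right]
  gcongr
  linarith

end bounds

end PlanarTuran

/-- Here `(k - 1) / 2` in `ℕ` is the floor of half of `k - 1`; as `11 ≤ k ≤ n`, no subtraction of
natural numbers below is truncated. -/
theorem theorem2p1 (n k r : ℕ) (hk : 11 ≤ k) (hn : k ≤ n)
    (hr : r = (n - 4) % (k - 6 + (k - 1) / 2)) :
    (n ≤ k - 5 + (k - 1) / 2 →
      SimpleGraph.planarTuranNumber n (SimpleGraph.cycleGraph k) = 3 * n - 6) ∧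
    (k - 4 + (k - 1) / 2 ≤ n →
      (3 - (3 - 2 / ((k : ℝ) - 1)) / ((k : ℝ) - 6 + ((k - 1) / 2 : ℕ))) * (n : ℝ)
          + (12 + 3 * (r : ℝ) - (8 + 2 * (r : ℝ)) / ((k : ℝ) - 1))
              / ((k : ℝ) - 6 + ((k - 1) / 2 : ℕ))
          + 4 / ((k : ℝ) - 1) - min ((r : ℝ) + 10) 11
        ≤ (SimpleGraph.planarTuranNumber n (SimpleGraph.cycleGraph k) : ℝ)) ∧
    (13 ≤ k → 5 * ((k : ℝ) - 6 + ((k - 1) / 2 : ℕ)) * ((k : ℝ) - 1) / 2 ≤ (n : ℝ) →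
      (3 - 3 / (k : ℝ)) * (n : ℝ) - 6 - 6 / (k : ℝ)
        < (SimpleGraph.planarTuranNumber n (SimpleGraph.cycleGraph k) : ℝ)) := by
  obtain ⟨t, ht⟩ : ∃ t, t = (k - 1) / 2 := ⟨_, rfl⟩
  obtain ⟨m, hm⟩ : ∃ m, m = k - 6 + t := ⟨_, rfl⟩
  have ht5 : 5 ≤ t := by omega
  have hmt : (k = 2 * t + 1 ∧ m = 3 * t - 5) ∨ (k = 2 * t + 2 ∧ m = 3 * t - 4) := by omega
  obtain ⟨q, hq⟩ : ∃ q, q = (n - 4) / m := ⟨_, rfl⟩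
  have hm0 : 0 < m := by omega
  rw [← ht, ← hm] at hr
  have hrm : r < m := hr ▸ Nat.mod_lt _ hm0
  have hnq : n = 4 + q * m + r := by
    have := Nat.div_add_mod' (n - 4) m
    rw [← hq, ← hr] at this
    omega
  have hmain := PlanarTuran.two_mul_add_four_le ht5 hmt hnq hrm
  have hmR : (k : ℝ) - 6 + (((k - 1) / 2 : ℕ) : ℝ) = m := by
    rw [← ht, hm]
    push_cast [Nat.cast_sub (show 6 ≤ k by omega)]
    ring
  rw [hmR, ← ht]
  have hmin : min ((r : ℝ) + 10) 11 = 10 + min (r : ℝ) 1 := by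
    rw [← min_add_add_left]
    norm_num [add_comm]
  rw [hmin]
  have hmain' : (2 * q + 4 : ℝ) ≤ (k - 1) *
      (SimpleGraph.planarTuranNumber n (SimpleGraph.cycleGraph k) - 3 * n + 3 * q + 10 +
        min (r : ℝ) 1) := by exact_mod_cast hmain
  have hmpos : (0 : ℝ) < m := by exact_mod_cast hm0
  have hkR : (11 : ℝ) ≤ k := by exact_mod_cast hk
  have hK : (0 : ℝ) < k - 1 := by linarith
  have hnR : (n : ℝ) = 4 + q * m + r := by exact_mod_cast hnq
  have hP := (div_le_iff₀' hK).2 hmain'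
  refine ⟨fun h => PlanarTuran.planarTuranNumber_cycleGraph_eq ht5 hmt (by omega) (by omega),
    fun _ => ?_, fun hk13 hlarge => ?_⟩
  -- With `n = 4 + q m + r` the expression in (ii) collapses to `3 n - 3 q + (2 q + 4) / (k - 1)`,
  -- up to the minimum.
  · have : (3 - (3 - 2 / ((k : ℝ) - 1)) / m) * (n : ℝ)
          + (12 + 3 * (r : ℝ) - (8 + 2 * (r : ℝ)) / ((k : ℝ) - 1)) / m + 4 / ((k : ℝ) - 1)
        = 3 * n - 3 * q + (2 * q + 4) / ((k : ℝ) - 1) := by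
      rw [hnR]
      field_simp
      ring
    rw [this]
    linarith
  -- Only here is `13 ≤ k` needed; for `k = 11` and `k = 12` one has `m = k - 1`.
  · have hkm : (k : ℝ) ≤ m := by exact_mod_cast (show k ≤ m by omega)
    have hk13R : (13 : ℝ) ≤ k := by exact_mod_cast hk13
    have hrR : (r : ℝ) + 1 ≤ m := by exact_mod_cast hrm
    have hr1 : min (r : ℝ) 1 ≤ 1 := min_le_right _ _
    -- The bound from (ii) subtracts up to 11 where the conjecture subtracts 6, so the gain `(2 q +
    -- 4) / (k - 1)` has to exceed 5. It does, as `n < (q + 1) m + 4` and `n` is at least `5 m (k -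
    -- 1) / 2`.
    have hqK : 5 * ((k : ℝ) - 1) < 2 * q + 4 := by
      by_contra! h
      have : (2 * q + 4) * (m : ℝ) ≤ 5 * ((k : ℝ) - 1) * m := by gcongr
      nlinarith
    have h5 : 5 < (2 * q + 4) / ((k : ℝ) - 1) := (lt_div_iff₀ hK).2 hqK
    have h3 : 3 * (q : ℝ) ≤ 3 * n / k := by
      rw [le_div_iff₀ (by linarith), hnR]
      have : (q : ℝ) * k ≤ q * m := by gcongr
      have : (0 : ℝ) ≤ r := Nat.cast_nonneg r
      linarith
    have h6 : 0 < 6 / (k : ℝ) := by positivity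
    have : (3 - 3 / (k : ℝ)) * n = 3 * n - 3 * n / k := by ring
    rw [this]
    linarith
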